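/- **Definitions.** For a function $f$, let $\partial_z f,\partial_{\bar z}f$ be its Wirtinger derivatives and $J_f=|\partial_z f|^2-|\partial_{\bar z}f|^2$ its Jacobian. A *non-degenerate harmonic mapping* is a complex-valued harmonic function $f$ on $\Omega=\mathbb C\setminus S$, where $S$ is a finite set of poles of $f$ (i.e. $\lim_{z\to z_0}f(z)=\infty$ for $z_0\in S$), such that near each $z_0\in S$ $$f(z)=\sum_{k=-n}^\infty a_k(z-z_0)^k+\overline{\sum_{k=-n}^\infty b_k(z-z_0)^k}+c\log|z-z_0|$$ with some $n\ge 1$, $c\in\mathbb C$ and $|a_{-n}|\neq|b_{-n}|$, and such that $J_f(z)>0$ for all sufficiently large $|z|$. Let $\mathcal C=\{z\in\Omega: J_f(z)=0\}$ be the critical set, $\omega=\overline{\partial_{\bar z}f}/\partial_z f$ the second complex dilatation (a meromorphic function on $\Omega$, with removable singularities removed), and $\mathcal M=\{z\in\mathcal C:|\omega(z)|\ne 1\}$. The set $\mathcal C$ is bounded, so $\mathbb C\setminus\mathcal C$ has exactly one unbounded connected component $A_\infty$. For a closed curve $\gamma$ and a point $\eta$ not on it, $\mathrm{wn}(\gamma;\eta)$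 is the winding number. The Poincaré index $\mathrm{ind}(g;z_0)$ of a function $g$ that is continuous and non-zero in a punctured neighborhood of $z_0\in\mathbb C$ is the winding number about $0$ of $g\circ\gamma$, where $\gamma$ is a small positively oriented circle about $z_0$. If $g$ is continuous and non-zero for all sufficiently large $|z|$, then $\mathrm{ind}(g;\infty)$ is the winding number about $0$ of $g\circ\gamma$, where $\gamma$ is a large negatively oriented circle about $0$. **Theorem.** Let $f$ be a non-degenerate harmonic mapping, $\eta\in\mathbb C$, and let $A$ be a connected component of $\mathbb C\setminus\mathcal C$ such that $f-\eta$ has no zero on $\partial A$. If $A=A_\infty$, assume also that $f(z)\ne\eta$ for all sufficiently large $|z|$, so that $\mathrm{ind}(f-\eta;\infty)$ is defined. Let $\gamma_j:[a_j,b_j]\to\mathbb C$, $a_j<b_j$, $j=1,\dots,n$ (where $n\ge0$), be closed curves parametrizing $\partial A\setminus\mathcal M$ according to $\omega(\gamma_j(t))=e^{it}$ and traveling through every critical arc once, that is: the union of their traces is $\partial A\setminus\mathcal M$, and each $z\in\partial A\setminus\mathcal M$ with $\omega'(z)\ne0$ equals $\gamma_j(t)$ for exactly one pair $(j,t)$ with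 $t\in[a_j,b_j)$. Let $P(f;A)=\sum_{z\in S\cap A}|\mathrm{ind}(f;z)|$. Then the number $N_\eta(f;A)$ of distinct pre-images of $\eta$ under $f$ in $A$ is finite, and $$N_\eta(f;A)=\begin{cases}\displaystyle\sum_{j=1}^n \mathrm{wn}(f\circ\gamma_j;\eta)+P(f;A) & \text{if } A\ne A_\infty,\\[2mm] \displaystyle\sum_{j=1}^n \mathrm{wn}(f\circ\gamma_j;\eta)+P(f;A)-\mathrm{ind}(f-\eta;\infty) & \text{if } A=A_\infty.\end{cases}$$ -/

import Mathlib

open Filter Topology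

namespace HarmonicCount

noncomputable section

/-- The Wirtinger derivative `∂f/∂z = (∂f/∂x - i ∂f/∂y) / 2`. -/
def dz (f : ℂ → ℂ) (z : ℂ) : ℂ :=
  (fderiv ℝ f z 1 - Complex.I * fderiv ℝ f z Complex.I) / 2

/-- The Wirtinger derivative `∂f/∂z̄ = (∂f/∂x + i ∂f/∂y) / 2`. -/
def dzbar (f : ℂ → ℂ) (z : ℂ) : ℂ :=
  (fderiv ℝ f z 1 + Complex.I * fderiv ℝ f z Complex.I) / 2

/-- The Jacobian `J_f = |∂f/∂z|² - |∂f/∂z̄|²`. -/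
def jacobian (f : ℂ → ℂ) (z : ℂ) : ℝ := ‖dz f z‖ ^ 2 - ‖dzbar f z‖ ^ 2

/-- `f` is a non-degenerate harmonic mapping whose set of poles is `S`; the values of `f` at the
points of `S` play no role. At a pole, the Laurent series of the two analytic parts starting with
the exponent `-n` are written as `(z - z₀)⁻ⁿ` times functions analytic at `z₀`, so that `H z₀` and
`G z₀` are the coefficients `a₋ₙ` and `b₋ₙ`. -/
structure NonDegenerate (f : ℂ → ℂ) (S : Finset ℂ) : Prop where
  harmonic : InnerProductSpace.HarmonicOnNhd f {z | z ∉ S}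
  pole : ∀ z₀ ∈ S, Tendsto f (𝓝[≠] z₀) (Bornology.cobounded ℂ)
  pole_form : ∀ z₀ ∈ S, ∃ (n : ℕ) (H G : ℂ → ℂ) (c : ℂ), 1 ≤ n ∧
    AnalyticAt ℂ H z₀ ∧ AnalyticAt ℂ G z₀ ∧ ‖H z₀‖ ≠ ‖G z₀‖ ∧
    ∀ᶠ z in 𝓝[≠] z₀,
      f z = H z / (z - z₀) ^ n + (starRingEnd ℂ) (G z / (z - z₀) ^ n)
        + c * (Real.log ‖z - z₀‖ : ℂ)
  sense_preserving_infty : ∀ᶠ z in Bornology.cobounded ℂ, 0 < jacobian f z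

/-- The critical set `𝒞` of a harmonic mapping `f` defined off `S`. -/
def critSet (f : ℂ → ℂ) (S : Finset ℂ) : Set ℂ := {z | z ∉ S ∧ jacobian f z = 0}

open Classical in
/-- The second complex dilatation `ω = conj (∂f/∂z̄) / (∂f/∂z)` with removable singularities
removed, i.e. the limit of this quotient at each point where it exists. At a pole of `ω`, where
`|ω| = ∞`, the value is `0`; this is harmless, as `ω` is only used through the conditions
`|ω| = 1` and `ω = exp (i t)`. -/
def dilatation (f : ℂ → ℂ) (z : ℂ) : ℂ :=
  if h : ∃ w : ℂ, Tendsto (fun ζ => (starRingEnd ℂ) (dzbar f ζ) / dz f ζ) (𝓝[≠] z) (𝓝 w)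
  then h.choose else 0

/-- The set `ℳ` of critical points with `|ω| ≠ 1`. -/
def exceptSet (f : ℂ → ℂ) (S : Finset ℂ) : Set ℂ := {z ∈ critSet f S | ‖dilatation f z‖ ≠ 1}

/-- `A` is one of the connected components of `ℂ ∖ 𝒞` (poles of `f` are not removed). -/
def IsTile (f : ℂ → ℂ) (S : Finset ℂ) (A : Set ℂ) : Prop :=
  ∃ z ∈ (critSet f S)ᶜ, A = connectedComponentIn (critSet f S)ᶜ z

/-- `θ` is a continuous argument of the nowhere vanishing function `g` on `[a, b]`. -/
def IsArgumentOn (g : ℝ → ℂ) (a b : ℝ) (θ : ℝ → ℝ) : Prop :=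
  ContinuousOn θ (Set.Icc a b) ∧
    ∀ t ∈ Set.Icc a b, g t ≠ 0 ∧ g t = (‖g t‖ : ℂ) * Complex.exp (θ t * Complex.I)

open Classical in
/-- The winding of `g : [a, b] → ℂ ∖ {0}` about `0`: the change of a continuous argument of `g`
from `a` to `b`, divided by `2π` (and `0` if `g` has no continuous argument). -/
def winding (g : ℝ → ℂ) (a b : ℝ) : ℝ :=
  if h : ∃ θ : ℝ → ℝ, IsArgumentOn g a b θ
  then (h.choose b - h.choose a) / (2 * Real.pi) else 0

/-- The winding number of the closed curve `c : [a, b] → ℂ` about `η`. -/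
def windingNumber (c : ℝ → ℂ) (a b : ℝ) (η : ℂ) : ℝ := winding (fun t => c t - η) a b

/-- The Poincaré index of `f` at an isolated exceptional point `z₀`: the winding of `f` on small
positively oriented circles about `z₀` (eventually independent of the radius). -/
def poincareIndex (f : ℂ → ℂ) (z₀ : ℂ) : ℝ :=
  limUnder (𝓝[>] (0 : ℝ)) fun r => winding (fun t => f (circleMap z₀ r t)) 0 (2 * Real.pi)

/-- The Poincaré index of `f` at `∞`: the winding of `f` on large negatively oriented circles
about the origin (eventually independent of the radius). -/
def poincareIndexInfty (f : ℂ → ℂ) : ℝ :=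
  limUnder atTop fun R : ℝ => winding (fun t => f (circleMap 0 R (-t))) 0 (2 * Real.pi)

open Classical in
/-- `P(f; A)`: the sum of `|ind(f; z)|` over the poles `z` of `f` in `A`. -/
def poleCount (f : ℂ → ℂ) (S : Finset ℂ) (A : Set ℂ) : ℝ :=
  ∑ z ∈ S with z ∈ A, |poincareIndex f z|

/-- `N_η(f; A)` counts this set: the pre-images of `η` under `f` in `A`. -/
def preimages (f : ℂ → ℂ) (S : Finset ℂ) (A : Set ℂ) (η : ℂ) : Set ℂ :=
  {z ∈ A | z ∉ S ∧ f z = η}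

/-- The closed curves `γ j : [a j, b j] → ℂ` parametrize `B`, a union of critical arcs, according
to `ω (γ (t)) = exp (i t)` and travel through every arc once: arcs end only at zeros of `ω'`, and
every other point of `B` is passed exactly once. -/
structure IsCritParam (f : ℂ → ℂ) (B : Set ℂ) {n : ℕ} (a b : Fin n → ℝ)
    (γ : Fin n → ℝ → ℂ) : Prop where
  lt : ∀ j, a j < b j
  continuousOn : ∀ j, ContinuousOn (γ j) (Set.Icc (a j) (b j))
  closed : ∀ j, γ j (a j) = γ j (b j)
  dilatation_eq : ∀ j, ∀ t ∈ Set.Icc (a j) (b j),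
    dilatation f (γ j t) = Complex.exp (t * Complex.I)
  trace_eq : ⋃ j, γ j '' Set.Icc (a j) (b j) = B
  once : ∀ z ∈ B, deriv (dilatation f) z ≠ 0 →
    ∃! p : Fin n × ℝ, p.2 ∈ Set.Ico (a p.1) (b p.1) ∧ γ p.1 p.2 = z

end

end HarmonicCount

/-! ### Continuous logarithms and winding numbers -/

namespace HarmonicCount

open Set Complex

/-! The count is an argument principle in which the curves γ_j play the role of the oriented
boundary of A. The Jacobian has a constant sign σ on A, also around the poles, so every zero of f -
η in A has index σ, and every pole in A has index -σ|ind(f; z)|. The sum of all indices in A is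
therefore σ(N - P).

The geometric heart is `IsCritParam.exists_sum_windingNumber_eq`: off ∂A, the total winding number
of the curves is σ·1_A + c. It is locally constant off ∂A. At all but finitely many points of ∂A the
dilatation ω is a local biholomorphism carrying the one passing curve to the unit circle, travelled
positively. By `exists_ball_windingNumber_jump` the total winding number is then larger by one on
the side |ω| < 1, which is the side J > 0. The remaining points (zeros of ∂f/∂z, zeros of ω', base
points of the curves; in particular all of ℳ ∩ ∂A) form a finite set, which does not disconnect the
plane, so a single constant c serves everywhere. Near infinity the winding number is zero: c = 0 for
bounded A, and c = -1 for unbounded A, where σ = 1.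

The analytic half needs no homology theory. `winding_comp_eq_sum` is an argument principle for
functions on the whole plane with finitely many exceptional points: these are divided out one at a
time, until a function with a global logarithm remains. `exists_extension` produces such a function:
f - η on a compact piece of closure A is blended with a constant -ε by a cutoff, and a Sard-type
choice of ε makes the new zeros nondegenerate, hence finite in number, and all of them lie off the
piece.

For bounded A the new zeros get total winding number 0 from the curves, so the winding of the image
curves is σ·σ(N - P) = N - P. For unbounded A the curves are combined with a large circle: together
they wind once about the points counted in A and not at all about the new zeros, and the winding of
f - η along the circle is -ind(f - η; ∞). -/

/-- A nowhere vanishing continuous function on a contractible, locally path connected space has a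
continuous logarithm. -/
theorem exists_continuous_log {X : Type*} [TopologicalSpace X] [ContractibleSpace X]
    [LocallyPathConnectedSpace X] {g : X → ℂ} (hg : Continuous g) (h0 : ∀ x, g x ≠ 0) :
    ∃ L : X → ℂ, Continuous L ∧ ∀ x, g x = exp (L x) := by
  have hU : IsSimplyConnected (univ : Set X) := by
    have : ContractibleSpace (univ : Set X) := (Homeomorph.Set.univ X).contractibleSpace
    exact SimplyConnectedSpace.ofContractible _
  obtain ⟨L, hL, hLg⟩ := exists_continuousOn_eqOn_exp_comp hU isOpen_univ hg.continuousOn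
    (by rintro ⟨x, -, hx⟩; exact h0 x hx)
  exact ⟨L, continuousOn_univ.1 hL, fun x => (hLg (mem_univ x)).symm⟩

/-- Extending `g` constantly beyond both endpoints reduces this to the contractible space ℝ. -/
theorem exists_log_Icc {g : ℝ → ℂ} {a b : ℝ} (hab : a ≤ b) (hg : ContinuousOn g (Icc a b))
    (h0 : ∀ t ∈ Icc a b, g t ≠ 0) :
    ∃ L : ℝ → ℂ, ContinuousOn L (Icc a b) ∧ ∀ t ∈ Icc a b, g t = exp (L t) := by
  have hc : Continuous (IccExtend hab ((Icc a b).domRestrict g)) :=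
    (continuousOn_iff_continuous_domRestrict.1 hg).Icc_extend'
  obtain ⟨L, hL, hLg⟩ := exists_continuous_log hc (fun t => h0 _ (projIcc a b hab t).2)
  refine ⟨L, hL.continuousOn, fun t ht => ?_⟩
  rw [← hLg t, IccExtend_of_mem _ _ ht]
  rfl

/-- Two continuous arguments differ by a continuous function with values in 2πℤ, hence by a
constant. This makes `winding` independent of the choice in its definition. -/
theorem IsArgumentOn.sub_eq_sub {g : ℝ → ℂ} {a b : ℝ} (hab : a ≤ b) {θ φ : ℝ → ℝ}
    (hθ : IsArgumentOn g a b θ) (hφ : IsArgumentOn g a b φ) : θ b - θ a = φ b - φ a := by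
  have hmem : ∀ t ∈ Icc a b, ∃ m : ℤ, θ t - φ t = m * (2 * Real.pi) := by
    intro t ht
    obtain ⟨h0, h1⟩ := hθ.2 t ht
    obtain ⟨-, h2⟩ := hφ.2 t ht
    have hn : (‖g t‖ : ℂ) ≠ 0 := by simpa using h0
    have h3 : exp (θ t * I) = exp (φ t * I) := mul_left_cancel₀ hn (h1.symm.trans h2)
    obtain ⟨m, hm⟩ := exp_eq_exp_iff_exists_int.1 h3
    refine ⟨m, ?_⟩
    have := congrArg Complex.im hm
    simp at this
    linarith
  have hc : ContinuousOn (fun t => (θ t - φ t) / (2 * Real.pi)) (Icc a b) :=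
    (hθ.1.sub hφ.1).div_const _
  have hpi : (2 * Real.pi) ≠ 0 := by positivity
  have hr : MapsTo (fun t => (θ t - φ t) / (2 * Real.pi)) (Icc a b)
      (range ((↑) : ℤ → ℝ)) := by
    intro t ht
    obtain ⟨m, hm⟩ := hmem t ht
    exact ⟨m, by simp only [hm]; field_simp⟩
  have hd : IsDiscrete (range ((↑) : ℤ → ℝ)) :=
    ⟨Int.isClosedEmbedding_coe_real.isEmbedding.toHomeomorph.symm.isEmbedding.discreteTopology⟩
  have := isPreconnected_Icc.constant_of_mapsTo hd hc hr (left_mem_Icc.2 hab) (right_mem_Icc.2 hab)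
  field_simp at this
  linarith

theorem isArgumentOn_of_exp {g L : ℝ → ℂ} {a b : ℝ} (hL : ContinuousOn L (Icc a b))
    (hg : ∀ t ∈ Icc a b, g t = exp (L t)) : IsArgumentOn g a b (fun t => (L t).im) := by
  refine ⟨continuous_im.comp_continuousOn hL, fun t ht => ?_⟩
  rw [hg t ht]
  refine ⟨exp_ne_zero _, ?_⟩
  rw [norm_exp, ofReal_exp, ← exp_add, re_add_im]

theorem winding_eq_of_exp {g L : ℝ → ℂ} {a b : ℝ} (hab : a ≤ b) (hL : ContinuousOn L (Icc a b))
    (hg : ∀ t ∈ Icc a b, g t = exp (L t)) :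
    winding g a b = ((L b).im - (L a).im) / (2 * Real.pi) := by
  have h : ∃ θ : ℝ → ℝ, IsArgumentOn g a b θ := ⟨_, isArgumentOn_of_exp hL hg⟩
  rw [winding, dif_pos h, IsArgumentOn.sub_eq_sub hab h.choose_spec (isArgumentOn_of_exp hL hg)]

/-- `winding` sees `g` only through the predicate `IsArgumentOn g a b`. Equal predicates give the
same chosen argument, so neither continuity nor non-vanishing is needed. -/
theorem winding_congr {g g' : ℝ → ℂ} {a b : ℝ} (h : EqOn g g' (Icc a b)) :
    winding g a b = winding g' a b := by
  have : IsArgumentOn g a b = IsArgumentOn g' a b := by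
    ext θ
    unfold IsArgumentOn
    refine and_congr_right fun _ => forall₂_congr fun t ht => ?_
    rw [h ht]
  exact congrArg (fun P : (ℝ → ℝ) → Prop =>
    haveI := Classical.propDecidable (∃ θ, P θ)
    if h : ∃ θ, P θ then (h.choose b - h.choose a) / (2 * Real.pi) else 0) this

theorem winding_mul {g g' : ℝ → ℂ} {a b : ℝ} (hab : a ≤ b) (hg : ContinuousOn g (Icc a b))
    (h0 : ∀ t ∈ Icc a b, g t ≠ 0) (hg' : ContinuousOn g' (Icc a b))
    (h0' : ∀ t ∈ Icc a b, g' t ≠ 0) :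
    winding (fun t => g t * g' t) a b = winding g a b + winding g' a b := by
  obtain ⟨L, hL, hLg⟩ := exists_log_Icc hab hg h0
  obtain ⟨L', hL', hLg'⟩ := exists_log_Icc hab hg' h0'
  rw [winding_eq_of_exp hab hL hLg, winding_eq_of_exp hab hL' hLg',
    winding_eq_of_exp hab (hL.add hL') (fun t ht => by
      rw [hLg t ht, hLg' t ht, Pi.add_apply, exp_add])]
  simp
  ring

theorem winding_div {g g' : ℝ → ℂ} {a b : ℝ} (hab : a ≤ b) (hg : ContinuousOn g (Icc a b))
    (h0 : ∀ t ∈ Icc a b, g t ≠ 0) (hg' : ContinuousOn g' (Icc a b))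
    (h0' : ∀ t ∈ Icc a b, g' t ≠ 0) :
    winding (fun t => g t / g' t) a b = winding g a b - winding g' a b := by
  have h1 := winding_mul hab (hg.div hg' h0') (fun t ht => div_ne_zero (h0 t ht) (h0' t ht)) hg' h0'
  have h2 : winding (fun t => (g / g') t * g' t) a b = winding g a b :=
    winding_congr fun t ht => by simp [h0' t ht]
  have h3 : winding (fun t => g t / g' t) a b = winding (g / g') a b := rfl
  rw [h3]
  linarith

theorem winding_add_adjacent {g : ℝ → ℂ} {a b c : ℝ} (hab : a ≤ b) (hbc : b ≤ c)
    (hg : ContinuousOn g (Icc a c)) (h0 : ∀ t ∈ Icc a c, g t ≠ 0) :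
    winding g a c = winding g a b + winding g b c := by
  obtain ⟨L, hL, hLg⟩ := exists_log_Icc (hab.trans hbc) hg h0
  have h1 : Icc a b ⊆ Icc a c := Icc_subset_Icc_right hbc
  have h2 : Icc b c ⊆ Icc a c := Icc_subset_Icc_left hab
  rw [winding_eq_of_exp (hab.trans hbc) hL hLg,
    winding_eq_of_exp hab (hL.mono h1) (fun t ht => hLg t (h1 ht)),
    winding_eq_of_exp hbc (hL.mono h2) (fun t ht => hLg t (h2 ht))]
  ring

theorem winding_const {c : ℂ} (hc : c ≠ 0) {a b : ℝ} (hab : a ≤ b) :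
    winding (fun _ => c) a b = 0 := by
  rw [winding_eq_of_exp (L := fun _ => log c) hab continuousOn_const
    (fun t _ => (exp_log hc).symm)]
  simp

theorem exists_int_winding_eq {g : ℝ → ℂ} {a b : ℝ} (hab : a ≤ b) (hg : ContinuousOn g (Icc a b))
    (h0 : ∀ t ∈ Icc a b, g t ≠ 0) (hcl : g a = g b) : ∃ m : ℤ, winding g a b = m := by
  obtain ⟨L, hL, hLg⟩ := exists_log_Icc hab hg h0
  rw [winding_eq_of_exp hab hL hLg]
  have h1 : exp (L b) = exp (L a) := by
    rw [← hLg a (left_mem_Icc.2 hab), ← hLg b (right_mem_Icc.2 hab), hcl]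
  obtain ⟨m, hm⟩ := exp_eq_exp_iff_exists_int.1 h1
  refine ⟨m, ?_⟩
  have hpi := Real.pi_pos
  have := congrArg Complex.im hm
  simp at this
  rw [this]
  field_simp
  ring

theorem winding_eq_of_slitPlane {g : ℝ → ℂ} {a b : ℝ} (hab : a ≤ b)
    (hg : ContinuousOn g (Icc a b)) (hs : ∀ t ∈ Icc a b, g t ∈ slitPlane) :
    winding g a b = (arg (g b) - arg (g a)) / (2 * Real.pi) := by
  rw [winding_eq_of_exp (L := fun t => log (g t)) hab (hg.clog hs)
    (fun t ht => (exp_log (slitPlane_ne_zero (hs t ht))).symm)]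
  simp [log_im]

theorem winding_eq_zero_of_slitPlane {g : ℝ → ℂ} {a b : ℝ} (hab : a ≤ b)
    (hg : ContinuousOn g (Icc a b)) (hs : ∀ t ∈ Icc a b, g t ∈ slitPlane) (hcl : g a = g b) :
    winding g a b = 0 := by
  rw [winding_eq_of_slitPlane hab hg hs, hcl]
  simp

theorem mem_slitPlane_of_norm_sub_one_lt {z : ℂ} (hz : ‖z - 1‖ < 1) : z ∈ slitPlane := by
  have := mem_slitPlane_of_norm_lt_one hz
  simpa using this

/-- From |log(1 + w)| ≤ (3/2)|w| the argument stays within 3/8 of zero, so it changes by at most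
3/4, and 2π > 6. The bound 1/8 leaves room for several such errors before an integer is ambiguous.
-/
theorem abs_winding_le_of_near_one {g : ℝ → ℂ} {a b : ℝ} (hab : a ≤ b)
    (hg : ContinuousOn g (Icc a b)) (hs : ∀ t ∈ Icc a b, ‖g t - 1‖ ≤ 1 / 4) :
    |winding g a b| ≤ 1 / 8 := by
  rw [winding_eq_of_slitPlane hab hg (fun t ht =>
    mem_slitPlane_of_norm_sub_one_lt ((hs t ht).trans_lt (by norm_num)))]
  have key : ∀ t ∈ Icc a b, |arg (g t)| ≤ 3 / 8 := by
    intro t ht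
    have h1 := norm_log_one_add_half_le_self ((hs t ht).trans (by norm_num))
    rw [add_sub_cancel] at h1
    have h2 := abs_im_le_norm (log (g t))
    rw [log_im] at h2
    have h3 := hs t ht
    linarith
  have ha := abs_le.1 (key a (left_mem_Icc.2 hab))
  have hb := abs_le.1 (key b (right_mem_Icc.2 hab))
  have hpi := Real.pi_gt_three
  rw [abs_div, abs_of_pos (by positivity : 0 < 2 * Real.pi), div_le_iff₀ (by positivity)]
  rw [abs_le]
  constructor <;> linarith [ha.1, ha.2, hb.1, hb.2]

/-- Closed curves that are close to each other relative to their distance from the origin wind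
equally often about the origin. -/
theorem winding_eq_of_norm_sub_lt {g g' : ℝ → ℂ} {a b : ℝ} (hab : a ≤ b)
    (hg : ContinuousOn g (Icc a b)) (hg' : ContinuousOn g' (Icc a b))
    (h : ∀ t ∈ Icc a b, ‖g' t - g t‖ < ‖g t‖) (hcl : g a = g b) (hcl' : g' a = g' b) :
    winding g' a b = winding g a b := by
  have h0 : ∀ t ∈ Icc a b, g t ≠ 0 := fun t ht h1 => by
    have := h t ht
    simp [h1] at this
    exact absurd this (not_lt.2 (norm_nonneg _))
  have h0' : ∀ t ∈ Icc a b, g' t ≠ 0 := fun t ht h1 => by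
    have := h t ht
    simp [h1] at this
  have h2 := winding_div hab hg' h0' hg h0
  have h3 : winding (fun t => g' t / g t) a b = 0 := by
    refine winding_eq_zero_of_slitPlane hab (hg'.div hg h0) (fun t ht => ?_) (by simp [hcl, hcl'])
    apply mem_slitPlane_of_norm_sub_one_lt
    rw [div_sub_one (h0 t ht), norm_div, div_lt_one (norm_pos_iff.2 (h0 t ht))]
    exact h t ht
  linarith

theorem winding_circleMap_sub_self (c : ℂ) {R : ℝ} (hR : 0 < R) (s : ℝ) :
    winding (fun t => circleMap c R t - c) s (s + 2 * Real.pi) = 1 := by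
  have hpi := Real.pi_pos
  rw [winding_eq_of_exp (L := fun t : ℝ => (Real.log R : ℂ) + t * I) (by linarith)
    (by fun_prop) (fun t _ => ?_)]
  · simp
  · rw [exp_add, ← ofReal_exp, Real.exp_log hR]
    simp [circleMap]

theorem circleMap_add_two_pi (c : ℂ) (R s : ℝ) :
    circleMap c R (s + 2 * Real.pi) = circleMap c R s := periodic_circleMap c R s

theorem windingNumber_circleMap_of_lt {c p : ℂ} {R : ℝ} (h : ‖p - c‖ < R) (s : ℝ) :
    windingNumber (circleMap c R) s (s + 2 * Real.pi) p = 1 := by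
  have hR : 0 < R := (norm_nonneg _).trans_lt h
  have hpi := Real.pi_pos
  rw [← winding_circleMap_sub_self c hR s, windingNumber]
  refine winding_eq_of_norm_sub_lt (by linarith) ?_ ?_ (fun t _ => ?_) ?_ ?_
  · exact ((continuous_circleMap c R).sub continuous_const).continuousOn
  · exact ((continuous_circleMap c R).sub continuous_const).continuousOn
  · rw [circleMap_sub_center, norm_circleMap_zero, abs_of_pos hR,
      show circleMap c R t - p - circleMap 0 R t = c - p by simp [circleMap]; ring, norm_sub_rev]
    exact h
  · simp [circleMap_add_two_pi]
  · simp [circleMap_add_two_pi]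

theorem windingNumber_circleMap_of_gt {c p : ℂ} {R : ℝ} (hR : 0 ≤ R) (h : R < ‖p - c‖) (s : ℝ) :
    windingNumber (circleMap c R) s (s + 2 * Real.pi) p = 0 := by
  have hpi := Real.pi_pos
  have h0 : c - p ≠ 0 := by
    rw [← norm_pos_iff, norm_sub_rev]; linarith
  rw [← winding_const h0 (show s ≤ s + 2 * Real.pi by linarith), windingNumber]
  refine winding_eq_of_norm_sub_lt (by linarith) continuousOn_const ?_ (fun t _ => ?_) rfl ?_
  · exact ((continuous_circleMap c R).sub continuous_const).continuousOn
  · have : circleMap c R t - p - (c - p) = circleMap 0 R t := by simp [circleMap]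
    rw [this, norm_circleMap_zero, abs_of_nonneg hR, norm_sub_rev]
    exact h
  · simp [circleMap_add_two_pi]

/-- Reversing the orientation of a circle changes the sign of the winding. -/
theorem winding_circleMap_neg {g : ℂ → ℂ} {R : ℝ}
    (hg : ContinuousOn (fun t => g (circleMap 0 R t)) (Icc 0 (2 * Real.pi)))
    (h0 : ∀ t ∈ Icc 0 (2 * Real.pi), g (circleMap 0 R t) ≠ 0) :
    winding (fun t => g (circleMap 0 R (-t))) 0 (2 * Real.pi) =
      -winding (fun t => g (circleMap 0 R t)) 0 (2 * Real.pi) := by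
  have hpi := Real.pi_pos
  obtain ⟨L, hL, hLg⟩ := exists_log_Icc (by positivity) hg h0
  have hm : MapsTo (fun t => 2 * Real.pi - t) (Icc 0 (2 * Real.pi)) (Icc 0 (2 * Real.pi)) :=
    fun t ht => ⟨by linarith [ht.2], by linarith [ht.1]⟩
  rw [winding_eq_of_exp (by positivity) hL hLg,
    winding_eq_of_exp (L := fun t => L (2 * Real.pi - t)) (by positivity)
      (hL.comp (by fun_prop) hm) (fun t ht => ?_)]
  · simp
    ring
  · rw [← hLg _ (hm ht)]
    beta_reduce
    rw [show 2 * Real.pi - t = -t + 2 * Real.pi by ring, circleMap_add_two_pi]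

/-- Winding numbers are locally constant off the curve. -/
theorem eventually_windingNumber_eq {c : ℝ → ℂ} {a b : ℝ} (hab : a ≤ b)
    (hc : ContinuousOn c (Icc a b)) (hcl : c a = c b) {p : ℂ} (hp : p ∉ c '' Icc a b) :
    ∀ᶠ q in 𝓝 p, windingNumber c a b q = windingNumber c a b p := by
  have hcomp : IsClosed (c '' Icc a b) := (isCompact_Icc.image_of_continuousOn hc).isClosed
  obtain ⟨r, hr, hball⟩ := Metric.isOpen_iff.1 hcomp.isOpen_compl p hp
  filter_upwards [Metric.ball_mem_nhds p hr] with q hq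
  refine winding_eq_of_norm_sub_lt hab (hc.sub continuousOn_const) (hc.sub continuousOn_const)
    (fun t ht => ?_) (by simp [hcl]) (by simp [hcl])
  have h1 : r ≤ dist (c t) p := by
    by_contra! h2
    exact hball h2 ⟨t, ht, rfl⟩
  rw [dist_eq_norm] at h1
  rw [sub_sub_sub_cancel_left, norm_sub_rev, ← dist_eq_norm]
  exact lt_of_lt_of_le hq h1

/-- Winding numbers vanish far away from the curve. -/
theorem eventually_windingNumber_eq_zero {c : ℝ → ℂ} {a b : ℝ} (hab : a ≤ b)
    (hc : ContinuousOn c (Icc a b)) (hcl : c a = c b) :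
    ∀ᶠ q in Bornology.cobounded ℂ, windingNumber c a b q = 0 := by
  obtain ⟨M, hM⟩ := (isCompact_Icc.image_of_continuousOn hc).isBounded.exists_norm_le
  have hev : ∀ᶠ q : ℂ in Bornology.cobounded ℂ, |M| < ‖q‖ :=
    tendsto_norm_cobounded_atTop.eventually (eventually_gt_atTop _)
  filter_upwards [hev] with q hq
  have hq0 : -q ≠ 0 := by
    rw [neg_ne_zero, ← norm_pos_iff]
    exact (abs_nonneg _).trans_lt hq
  rw [← winding_const hq0 hab, windingNumber]
  refine winding_eq_of_norm_sub_lt hab continuousOn_const (hc.sub continuousOn_const)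
    (fun t ht => ?_) rfl (by simp [hcl])
  have := hM (c t) ⟨t, ht, rfl⟩
  simp only [sub_neg_eq_add, sub_add_cancel, norm_neg]
  exact (this.trans (le_abs_self M)).trans_lt hq

end HarmonicCount

/-! ### Local index and the topological argument principle -/

namespace HarmonicCount

open Set Complex

/-- `g` has index `k` at `z`: near `z` it is `(w - z) ^ k` times a function with a continuous
logarithm. -/
def HasIndexAt (g : ℂ → ℂ) (z : ℂ) (k : ℤ) : Prop :=
  ∃ r > 0, ∃ L : ℂ → ℂ, ContinuousOn L (Metric.ball z r \ {z}) ∧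
    ∀ w ∈ Metric.ball z r \ {z}, g w = (w - z) ^ k * exp (L w)

theorem eventually_punctured_iff {p : ℂ → Prop} {z : ℂ} :
    (∀ᶠ w in 𝓝[≠] z, p w) ↔ ∃ r > 0, ∀ w ∈ Metric.ball z r \ {z}, p w := by
  rw [(nhdsWithin_hasBasis Metric.nhds_basis_ball {z}ᶜ).eventually_iff]
  rfl

theorem isOpen_punctured_ball (z : ℂ) (r : ℝ) : IsOpen (Metric.ball z r \ {z}) :=
  Metric.isOpen_ball.sdiff isClosed_singleton

theorem HasIndexAt.congr {g g' : ℂ → ℂ} {z : ℂ} {k : ℤ} (h : HasIndexAt g z k)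
    (hgg' : g =ᶠ[𝓝[≠] z] g') : HasIndexAt g' z k := by
  obtain ⟨r, hr, L, hL, hg⟩ := h
  obtain ⟨s, hs, hgs⟩ := eventually_punctured_iff.1 hgg'
  have h1 : Metric.ball z (min r s) \ {z} ⊆ Metric.ball z r \ {z} :=
    sdiff_subset_sdiff_left (Metric.ball_subset_ball (min_le_left _ _))
  have h2 : Metric.ball z (min r s) \ {z} ⊆ Metric.ball z s \ {z} :=
    sdiff_subset_sdiff_left (Metric.ball_subset_ball (min_le_right _ _))
  exact ⟨min r s, lt_min hr hs, L, hL.mono h1, fun w hw => by rw [← hgs w (h2 hw), hg w (h1 hw)]⟩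

theorem HasIndexAt.mul {g g' : ℂ → ℂ} {z : ℂ} {k l : ℤ} (h : HasIndexAt g z k)
    (h' : HasIndexAt g' z l) : HasIndexAt (fun w => g w * g' w) z (k + l) := by
  obtain ⟨r, hr, L, hL, hg⟩ := h
  obtain ⟨s, hs, L', hL', hg'⟩ := h'
  have h1 : Metric.ball z (min r s) \ {z} ⊆ Metric.ball z r \ {z} :=
    sdiff_subset_sdiff_left (Metric.ball_subset_ball (min_le_left _ _))
  have h2 : Metric.ball z (min r s) \ {z} ⊆ Metric.ball z s \ {z} :=
    sdiff_subset_sdiff_left (Metric.ball_subset_ball (min_le_right _ _))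
  refine ⟨min r s, lt_min hr hs, fun w => L w + L' w, (hL.mono h1).add (hL'.mono h2),
    fun w hw => ?_⟩
  beta_reduce
  rw [hg w (h1 hw), hg' w (h2 hw), exp_add, zpow_add₀ (sub_ne_zero.2 hw.2)]
  ring

theorem hasIndexAt_zero_of_slitPlane {g : ℂ → ℂ} {z : ℂ}
    (h : ∀ᶠ w in 𝓝[≠] z, ContinuousAt g w ∧ g w ∈ slitPlane) : HasIndexAt g z 0 := by
  obtain ⟨r, hr, hg⟩ := eventually_punctured_iff.1 h
  refine ⟨r, hr, fun w => log (g w), fun w hw => ?_, fun w hw => ?_⟩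
  · exact ((hg w hw).1.clog (hg w hw).2).continuousWithinAt
  · simp [exp_log (slitPlane_ne_zero (hg w hw).2)]

theorem hasIndexAt_const {c : ℂ} (hc : c ≠ 0) (z : ℂ) : HasIndexAt (fun _ => c) z 0 :=
  ⟨1, one_pos, fun _ => log c, continuousOn_const, fun w _ => by simp [exp_log hc]⟩

theorem hasIndexAt_zpow (z : ℂ) (k : ℤ) : HasIndexAt (fun w => (w - z) ^ k) z k :=
  ⟨1, one_pos, fun _ => 0, continuousOn_const, fun w _ => by simp⟩

/-- The conjugate of u^k is u^(-k)·|u|^(2k), and the positive factor has the real logarithm 2k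
log|u|. -/
theorem hasIndexAt_conj_zpow (z : ℂ) (k : ℤ) :
    HasIndexAt (fun w => (starRingEnd ℂ) ((w - z) ^ k)) z (-k) := by
  refine ⟨1, one_pos, fun w => ((k * (2 * Real.log ‖w - z‖) : ℝ) : ℂ), fun w hw => ?_,
    fun w hw => ?_⟩
  · have hw0 : ‖w - z‖ ≠ 0 := by simpa [sub_eq_zero] using hw.2
    have : ContinuousAt (fun w : ℂ => Real.log ‖w - z‖) w :=
      ContinuousAt.log (by fun_prop) hw0
    exact (continuous_ofReal.continuousAt.comp
      (continuousAt_const.mul (continuousAt_const.mul this))).continuousWithinAt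
  · have hw0 : w - z ≠ 0 := sub_ne_zero.2 hw.2
    have h1 : exp (2 * Real.log ‖w - z‖ : ℝ) = (w - z) * (starRingEnd ℂ) (w - z) := by
      rw [mul_conj, ← ofReal_exp, two_mul, Real.exp_add, Real.exp_log (norm_pos_iff.2 hw0),
        normSq_eq_norm_sq, sq]
    have h2 : exp ((k * (2 * Real.log ‖w - z‖) : ℝ) : ℂ) =
        ((w - z) * (starRingEnd ℂ) (w - z)) ^ k := by
      rw [← h1, ← exp_int_mul]
      push_cast
      rfl
    beta_reduce
    rw [h2, mul_zpow, map_zpow₀, zpow_neg, inv_mul_cancel_left₀ (zpow_ne_zero _ hw0)]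

theorem HasIndexAt.eventually_ne_zero {g : ℂ → ℂ} {z : ℂ} {k : ℤ} (h : HasIndexAt g z k) :
    ∀ᶠ w in 𝓝[≠] z, g w ≠ 0 := by
  obtain ⟨r, hr, L, hL, hg⟩ := h
  refine eventually_punctured_iff.2 ⟨r, hr, fun w hw => ?_⟩
  rw [hg w hw]
  exact mul_ne_zero (zpow_ne_zero _ (sub_ne_zero.2 hw.2)) (exp_ne_zero _)

theorem HasIndexAt.eventually_continuousAt {g : ℂ → ℂ} {z : ℂ} {k : ℤ} (h : HasIndexAt g z k) :
    ∀ᶠ w in 𝓝[≠] z, ContinuousAt g w := by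
  obtain ⟨r, hr, L, hL, hg⟩ := h
  refine eventually_punctured_iff.2 ⟨r, hr, fun w hw => ?_⟩
  have hn := (isOpen_punctured_ball z r).mem_nhds hw
  have h1 : ContinuousAt (fun w => (w - z) ^ k * exp (L w)) w :=
    ((continuousAt_id.sub continuousAt_const).zpow₀ k (Or.inl (sub_ne_zero.2 hw.2))).mul
      (hL.continuousAt hn).cexp
  exact h1.congr (by filter_upwards [hn] with v hv using (hg v hv).symm)

/-- The index is stable under relatively small perturbations. -/
theorem HasIndexAt.of_norm_sub_lt {g m : ℂ → ℂ} {z : ℂ} {k : ℤ} (hm : HasIndexAt m z k)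
    (hg : ∀ᶠ w in 𝓝[≠] z, ContinuousAt g w) (h : ∀ᶠ w in 𝓝[≠] z, ‖g w - m w‖ < ‖m w‖) :
    HasIndexAt g z k := by
  have h1 : HasIndexAt (fun w => g w / m w) z 0 := by
    apply hasIndexAt_zero_of_slitPlane
    filter_upwards [hm.eventually_ne_zero, hm.eventually_continuousAt, hg, h] with w h0 hmc hgc hlt
    refine ⟨hgc.div hmc h0, mem_slitPlane_of_norm_sub_one_lt ?_⟩
    rwa [div_sub_one h0, norm_div, div_lt_one (norm_pos_iff.2 h0)]
  have h2 := hm.mul h1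
  rw [add_zero] at h2
  refine h2.congr ?_
  filter_upwards [hm.eventually_ne_zero] with w h0
  field_simp

theorem hasIndexAt_zero_of_continuousAt {g : ℂ → ℂ} {z : ℂ} (h0 : g z ≠ 0)
    (hg : ∀ᶠ w in 𝓝 z, ContinuousAt g w) : HasIndexAt g z 0 := by
  refine (hasIndexAt_const h0 z).of_norm_sub_lt (hg.filter_mono nhdsWithin_le_nhds) ?_
  have h1 : Tendsto (fun w => ‖g w - g z‖) (𝓝 z) (𝓝 0) := by
    simpa using ((hg.self_of_nhds.sub continuousAt_const).norm : ContinuousAt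
      (fun w => ‖g w - g z‖) z).tendsto
  exact (h1.eventually_lt_const (norm_pos_iff.2 h0)).filter_mono nhdsWithin_le_nhds

theorem winding_zpow {g : ℝ → ℂ} {a b : ℝ} (hab : a ≤ b) (hg : ContinuousOn g (Icc a b))
    (h0 : ∀ t ∈ Icc a b, g t ≠ 0) (k : ℤ) :
    winding (fun t => g t ^ k) a b = k * winding g a b := by
  obtain ⟨L, hL, hLg⟩ := exists_log_Icc hab hg h0
  rw [winding_eq_of_exp hab hL hLg, winding_eq_of_exp (L := fun t => k * L t) hab
    (continuousOn_const.mul hL) (fun t ht => by rw [hLg t ht, exp_int_mul])]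
  simp
  ring

/-- On the circle the factor (w - z)^k winds k times. The factor exp ∘ L does not wind, because L
itself is single-valued along the closed circle. -/
theorem winding_circleMap_eq_of_log {f : ℂ → ℂ} {z : ℂ} {k : ℤ} {r ρ : ℝ} {L : ℂ → ℂ}
    (hL : ContinuousOn L (Metric.ball z r \ {z}))
    (hf : ∀ w ∈ Metric.ball z r \ {z}, f w = (w - z) ^ k * exp (L w)) (hρ : 0 < ρ) (hρr : ρ < r) :
    winding (fun t => f (circleMap z ρ t)) 0 (2 * Real.pi) = k := by
  have hpi := Real.pi_pos
  have hm : ∀ t, circleMap z ρ t ∈ Metric.ball z r \ {z} := fun t =>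
    ⟨by rw [mem_ball_iff_norm, circleMap_sub_center, norm_circleMap_zero, abs_of_pos hρ]; exact hρr,
      circleMap_ne_center hρ.ne'⟩
  have hLc : Continuous (fun t => L (circleMap z ρ t)) := by
    rw [← continuousOn_univ]
    exact hL.comp (continuous_circleMap z ρ).continuousOn (fun t _ => hm t)
  have h1 := winding_circleMap_sub_self z hρ 0
  rw [zero_add] at h1
  have hcc : ContinuousOn (fun t => circleMap z ρ t - z) (Icc 0 (2 * Real.pi)) :=
    ((continuous_circleMap z ρ).sub continuous_const).continuousOn
  have hne : ∀ t ∈ Icc 0 (2 * Real.pi), circleMap z ρ t - z ≠ 0 :=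
    fun t _ => sub_ne_zero.2 (hm t).2
  rw [winding_congr (fun t _ => hf _ (hm t)),
    winding_mul (by positivity) (hcc.zpow₀ k fun t ht => Or.inl (hne t ht))
      (fun t ht => zpow_ne_zero _ (hne t ht)) hLc.cexp.continuousOn (fun _ _ => exp_ne_zero _),
    winding_zpow (by positivity) hcc hne, h1,
    winding_eq_of_exp (by positivity) hLc.continuousOn (fun _ _ => rfl)]
  have h2 := circleMap_add_two_pi z ρ 0
  rw [zero_add] at h2
  simp [h2]

theorem HasIndexAt.poincareIndex_eq {f : ℂ → ℂ} {z : ℂ} {k : ℤ} (h : HasIndexAt f z k) :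
    poincareIndex f z = k := by
  obtain ⟨r, hr, L, hL, hf⟩ := h
  apply Tendsto.limUnder_eq
  refine tendsto_const_nhds.congr' ?_
  filter_upwards [Ioo_mem_nhdsGT hr] with ρ hρ
  exact (winding_circleMap_eq_of_log hL hf hρ.1 hρ.2).symm

/-- **Topological argument principle**: the winding about `0` of the image of a closed curve under a
function with finitely many exceptional points in the plane. -/
theorem winding_comp_eq_sum (k : ℂ → ℤ) (Z : Finset ℂ) (g : ℂ → ℂ)
    (hg : ∀ z ∉ Z, ContinuousAt g z) (h0 : ∀ z ∉ Z, g z ≠ 0)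
    (hk : ∀ z ∈ Z, HasIndexAt g z (k z)) {c : ℝ → ℂ} {a b : ℝ} (hab : a ≤ b)
    (hc : ContinuousOn c (Icc a b)) (hcl : c a = c b) (hcZ : ∀ t ∈ Icc a b, c t ∉ Z) :
    winding (fun t => g (c t)) a b = ∑ z ∈ Z, k z * windingNumber c a b z := by
  classical
  induction Z using Finset.induction_on generalizing g with
  | empty =>
    -- Without exceptional points there is a logarithm on the whole plane, which returns to its
    -- initial value along a closed curve.
    have hgc : Continuous g := continuous_iff_continuousAt.2 fun z => hg z (by simp)
    obtain ⟨L, hL, hLg⟩ := exists_continuous_log hgc (fun z => h0 z (by simp))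
    rw [winding_eq_of_exp (L := fun t => L (c t)) hab (hL.comp_continuousOn hc)
      (fun t _ => hLg _), hcl]
    simp
  | insert z Z hz ih =>
    obtain ⟨r, hr, L, hL, hgL⟩ := hk z (Finset.mem_insert_self z Z)
    have hopen : IsOpen ((c '' Icc a b) ∪ Z)ᶜ :=
      ((isCompact_Icc.image_of_continuousOn hc).isClosed.union
        Z.finite_toSet.isClosed).isOpen_compl
    have hzmem : z ∈ ((c '' Icc a b) ∪ Z)ᶜ := by
      rintro (⟨t, ht, htz⟩ | h)
      · exact hcZ t ht (by simp [htz])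
      · exact hz h
    obtain ⟨s, hs, hsub⟩ := Metric.isOpen_iff.1 hopen z hzmem
    set ρ := min r s with hρdef
    have hρ : 0 < ρ := lt_min hr hs
    have hρr : Metric.ball z ρ \ {z} ⊆ Metric.ball z r \ {z} :=
      sdiff_subset_sdiff_left (Metric.ball_subset_ball (min_le_left _ _))
    have hρs : Metric.ball z ρ ⊆ ((c '' Icc a b) ∪ Z)ᶜ :=
      (Metric.ball_subset_ball (min_le_right _ _)).trans hsub
    -- The cutoff is 0 within distance ρ/3 of z and 1 beyond 2ρ/3. Inside the ball, g·(w - z)^(-k z)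
    -- is exp L; scaling L by χ replaces it by 1 near z. The result `g'` is continuous and non-zero
    -- at z and unchanged near the curve and near the other exceptional points, so the induction
    -- hypothesis applies to it.
    let χ : ℂ → ℝ := fun w => max 0 (min 1 (3 * dist w z / ρ - 1))
    have hχ : Continuous χ := by fun_prop
    let g' : ℂ → ℂ := fun w =>
      if dist w z < ρ then exp (χ w * L w) else g w * (w - z) ^ (-k z)
    have hfar : ∀ w, 2 * ρ / 3 < dist w z → g' w = g w * (w - z) ^ (-k z) := by
      intro w hw
      by_cases hlt : dist w z < ρ
      · have hwz : w ≠ z := by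
          rintro rfl
          rw [dist_self] at hw
          linarith
        have hχ1 : χ w = 1 := by
          have : 1 ≤ 3 * dist w z / ρ - 1 := by
            rw [le_sub_iff_add_le, le_div_iff₀ hρ]
            linarith
          simp [χ, this]
        simp only [g', if_pos hlt, hχ1]
        rw [hgL w (hρr ⟨hlt, hwz⟩), zpow_neg]
        have := zpow_ne_zero (k z) (sub_ne_zero.2 hwz)
        field_simp
        simp
      · simp only [g', if_neg hlt]
    have hfar' : ∀ w, 2 * ρ / 3 < dist w z → g' =ᶠ[𝓝 w] fun w => g w * (w - z) ^ (-k z) := by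
      intro w hw
      have : ∀ᶠ v in 𝓝 w, 2 * ρ / 3 < dist v z :=
        (continuous_id.dist continuous_const).continuousAt.eventually_const_lt hw
      filter_upwards [this] with v hv using hfar v hv
    have hne : ∀ w, 2 * ρ / 3 < dist w z → w - z ≠ 0 := by
      intro w hw h
      rw [sub_eq_zero.1 h, dist_self] at hw
      linarith
    have hpow : ∀ w, w - z ≠ 0 → ContinuousAt (fun w => (w - z) ^ (-k z)) w := fun w hw =>
      (continuousAt_id.sub continuousAt_const).zpow₀ _ (Or.inl hw)
    have hdistZ : ∀ w ∈ Z, 2 * ρ / 3 < dist w z := by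
      intro w hw
      by_contra! h
      exact hρs (show w ∈ Metric.ball z ρ by rw [Metric.mem_ball]; linarith) (Or.inr hw)
    have hdistc : ∀ t ∈ Icc a b, 2 * ρ / 3 < dist (c t) z := by
      intro t ht
      by_contra! h
      exact hρs (show c t ∈ Metric.ball z ρ by rw [Metric.mem_ball]; linarith)
        (Or.inl ⟨t, ht, rfl⟩)
    have hcont : ∀ w ∉ Z, ContinuousAt g' w := by
      intro w hw
      by_cases hwz : w = z
      · subst hwz
        have : ∀ᶠ v in 𝓝 w, g' v = 1 := by
          filter_upwards [Metric.ball_mem_nhds w (show 0 < ρ / 3 by positivity)] with v hv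
          rw [Metric.mem_ball] at hv
          have hχ0 : χ v = 0 := by
            have : 3 * dist v w / ρ - 1 ≤ 0 := by
              rw [sub_nonpos, div_le_iff₀ hρ]
              linarith
            simp only [χ]
            rw [max_eq_left]
            exact (min_le_right _ _).trans this
          simp only [g', if_pos (show dist v w < ρ by linarith), hχ0]
          simp
        exact continuousAt_const.congr (EventuallyEq.symm this)
      · have hwi : w ∉ insert z Z := by simp [hwz, hw]
        by_cases hd : dist w z < ρ
        · have hmem : Metric.ball z ρ \ {z} ∈ 𝓝 w :=
            (isOpen_punctured_ball z ρ).mem_nhds ⟨hd, hwz⟩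
          have hLw : ContinuousAt L w := (hL.mono hρr).continuousAt hmem
          have h1 : ContinuousAt (fun w => exp (χ w * L w)) w :=
            ((continuous_ofReal.comp hχ).continuousAt.mul hLw).cexp
          refine h1.congr ?_
          filter_upwards [hmem] with v hv
          simp only [g', if_pos (show dist v z < ρ from hv.1)]
        · have h2 : 2 * ρ / 3 < dist w z := by linarith
          exact ((hg w hwi).mul (hpow w (hne w h2))).congr (hfar' w h2).symm
    have hnz : ∀ w ∉ Z, g' w ≠ 0 := by
      intro w hw
      by_cases hd : dist w z < ρ
      · simp only [g', if_pos hd]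
        exact exp_ne_zero _
      · have h2 : 2 * ρ / 3 < dist w z := by linarith
        rw [hfar w h2]
        refine mul_ne_zero (h0 w ?_) (zpow_ne_zero _ (hne w h2))
        simp [hw, sub_ne_zero.1 (hne w h2)]
    have hidx : ∀ w ∈ Z, HasIndexAt g' w (k w) := by
      intro w hw
      have h2 := hdistZ w hw
      have h3 : HasIndexAt (fun w => (w - z) ^ (-k z)) w 0 := by
        refine hasIndexAt_zero_of_continuousAt (zpow_ne_zero _ (hne w h2)) ?_
        have : ∀ᶠ v in 𝓝 w, v - z ≠ 0 :=
          (continuousAt_id.sub continuousAt_const).eventually_ne (hne w h2)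
        filter_upwards [this] with v hv using hpow v hv
      have h4 := (hk w (Finset.mem_insert_of_mem hw)).mul h3
      rw [add_zero] at h4
      exact h4.congr ((hfar' w h2).symm.filter_mono nhdsWithin_le_nhds)
    have hIH := ih g' hcont hnz hidx (fun t ht h => hcZ t ht (Finset.mem_insert_of_mem h))
    have hcc : ContinuousOn (fun t => c t - z) (Icc a b) := hc.sub continuousOn_const
    have hcn : ∀ t ∈ Icc a b, c t - z ≠ 0 := fun t ht => hne _ (hdistc t ht)
    have hsplit : winding (fun t => g (c t)) a b =
        winding (fun t => g' (c t) * (c t - z) ^ k z) a b := by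
      refine winding_congr fun t ht => ?_
      have := zpow_ne_zero (k z) (hcn t ht)
      simp only [hfar _ (hdistc t ht), zpow_neg]
      field_simp
    have hcZ' : ∀ t ∈ Icc a b, c t ∉ Z := fun t ht h => hcZ t ht (Finset.mem_insert_of_mem h)
    have hg'c : ContinuousOn (fun t => g' (c t)) (Icc a b) := fun t ht =>
      (hcont _ (hcZ' t ht)).comp_continuousWithinAt (hc t ht)
    rw [hsplit, winding_mul hab hg'c (fun t ht => hnz _ (hcZ' t ht))
      (hcc.zpow₀ _ fun t ht => Or.inl (hcn t ht)) (fun t ht => zpow_ne_zero _ (hcn t ht)), hIH,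
      winding_zpow hab hcc hcn, Finset.sum_insert hz, windingNumber]
    ring

end HarmonicCount

/-! ### Nondegenerate zeros, regular values and extension to the plane -/

namespace HarmonicCount

open Set Complex

theorem fderiv_apply_eq (g : ℂ → ℂ) (z v : ℂ) :
    fderiv ℝ g z v = dz g z * v + dzbar g z * (starRingEnd ℂ) v := by
  have hv : v = v.re • (1 : ℂ) + v.im • I := by simp
  conv_lhs => rw [hv]
  rw [map_add, map_smul, map_smul, dz, dzbar]
  conv_rhs => rw [← re_add_im v]
  simp only [map_add, map_mul, conj_ofReal, conj_I, real_smul]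
  linear_combination ((v.im : ℂ) * fderiv ℝ g z I) * I_mul_I

theorem det_fderiv_eq_jacobian (g : ℂ → ℂ) (z : ℂ) : (fderiv ℝ g z).det = jacobian g z := by
  have h : (fderiv ℝ g z).det =
      (fderiv ℝ g z 1).re * (fderiv ℝ g z I).im - (fderiv ℝ g z I).re * (fderiv ℝ g z 1).im := by
    rw [ContinuousLinearMap.det, ← LinearMap.det_toMatrix basisOneI, Matrix.det_fin_two]
    simp [LinearMap.toMatrix_apply]
  rw [h, jacobian, dz, dzbar, ← normSq_eq_norm_sq, ← normSq_eq_norm_sq]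
  simp [normSq_apply]
  ring

/-- A zero at which the Jacobian is positive has index `1`. -/
theorem hasIndexAt_one_of_jacobian_pos {g : ℂ → ℂ} {z : ℂ} (hz : g z = 0)
    (hd : DifferentiableAt ℝ g z) (hc : ∀ᶠ w in 𝓝 z, ContinuousAt g w) (hJ : 0 < jacobian g z) :
    HasIndexAt g z 1 := by
  have hlt : ‖dzbar g z‖ < ‖dz g z‖ := by
    rw [jacobian] at hJ
    exact lt_of_pow_lt_pow_left₀ 2 (norm_nonneg _) (by linarith)
  have hm : HasIndexAt (fun w => dz g z * (w - z)) z 1 := by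
    have := (hasIndexAt_const (norm_pos_iff.1 ((norm_nonneg _).trans_lt hlt)) z).mul
      (hasIndexAt_zpow z 1)
    simpa using this
  refine hm.of_norm_sub_lt (hc.filter_mono nhdsWithin_le_nhds) ?_
  -- Half the gap between the coefficients: the conjugate-linear term and the Taylor remainder
  -- together stay strictly below the complex-linear term.
  have hε : 0 < (‖dz g z‖ - ‖dzbar g z‖) / 2 := by linarith
  have h1 := (hasFDerivAt_iff_isLittleO.1 hd.hasFDerivAt).def hε
  filter_upwards [h1.filter_mono nhdsWithin_le_nhds, self_mem_nhdsWithin] with w hw hne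
  have hpos : 0 < ‖w - z‖ := norm_pos_iff.2 (sub_ne_zero.2 hne)
  rw [fderiv_apply_eq, hz, sub_zero] at hw
  calc ‖g w - dz g z * (w - z)‖
      = ‖(g w - (dz g z * (w - z) + dzbar g z * (starRingEnd ℂ) (w - z))) +
          dzbar g z * (starRingEnd ℂ) (w - z)‖ := by congr 1; ring
    _ ≤ (‖dz g z‖ - ‖dzbar g z‖) / 2 * ‖w - z‖ + ‖dzbar g z‖ * ‖w - z‖ := by
        refine (norm_add_le _ _).trans (add_le_add hw ?_)
        rw [norm_mul, norm_conj]
    _ < ‖dz g z‖ * ‖w - z‖ := by nlinarith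
    _ = ‖dz g z * (w - z)‖ := (norm_mul _ _).symm

/-- A zero at which the Jacobian is negative has index `-1`. -/
theorem hasIndexAt_neg_one_of_jacobian_neg {g : ℂ → ℂ} {z : ℂ} (hz : g z = 0)
    (hd : DifferentiableAt ℝ g z) (hc : ∀ᶠ w in 𝓝 z, ContinuousAt g w) (hJ : jacobian g z < 0) :
    HasIndexAt g z (-1) := by
  have hlt : ‖dz g z‖ < ‖dzbar g z‖ := by
    rw [jacobian] at hJ
    exact lt_of_pow_lt_pow_left₀ 2 (norm_nonneg _) (by linarith)
  have hm : HasIndexAt (fun w => dzbar g z * (starRingEnd ℂ) (w - z)) z (-1) := by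
    have := (hasIndexAt_const (norm_pos_iff.1 ((norm_nonneg _).trans_lt hlt)) z).mul
      (hasIndexAt_conj_zpow z 1)
    simpa using this
  refine hm.of_norm_sub_lt (hc.filter_mono nhdsWithin_le_nhds) ?_
  have hε : 0 < (‖dzbar g z‖ - ‖dz g z‖) / 2 := by linarith
  have h1 := (hasFDerivAt_iff_isLittleO.1 hd.hasFDerivAt).def hε
  filter_upwards [h1.filter_mono nhdsWithin_le_nhds, self_mem_nhdsWithin] with w hw hne
  have hpos : 0 < ‖w - z‖ := norm_pos_iff.2 (sub_ne_zero.2 hne)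
  rw [fderiv_apply_eq, hz, sub_zero] at hw
  calc ‖g w - dzbar g z * (starRingEnd ℂ) (w - z)‖
      = ‖(g w - (dz g z * (w - z) + dzbar g z * (starRingEnd ℂ) (w - z))) +
          dz g z * (w - z)‖ := by congr 1; ring
    _ ≤ (‖dzbar g z‖ - ‖dz g z‖) / 2 * ‖w - z‖ + ‖dz g z‖ * ‖w - z‖ := by
        refine (norm_add_le _ _).trans (add_le_add hw ?_)
        rw [norm_mul]
    _ < ‖dzbar g z‖ * ‖w - z‖ := by nlinarith
    _ = ‖dzbar g z * (starRingEnd ℂ) (w - z)‖ := by rw [norm_mul, norm_conj]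

/-- Regular values exist: a map that is differentiable on an open set has a nonzero value `ε` all
of whose pre-images have non-vanishing Jacobian. -/
theorem exists_regular_value {ρ : ℂ → ℂ} {O : Set ℂ} (hρ : ∀ z ∈ O, DifferentiableAt ℝ ρ z) :
    ∃ ε : ℂ, ε ≠ 0 ∧ ∀ z ∈ O, ρ z = ε → jacobian ρ z ≠ 0 := by
  let s : Set ℂ := {z | z ∈ O ∧ jacobian ρ z = 0}
  -- The equal-dimensional case of Sard's theorem, which needs only differentiability. Adding the
  -- point 0 to the null set then forces ε ≠ 0.
  have h1 : MeasureTheory.volume (ρ '' s) = 0 :=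
    MeasureTheory.addHaar_image_eq_zero_of_det_fderivWithin_eq_zero _
      (fun z hz => (hρ z hz.1).hasFDerivAt.hasFDerivWithinAt)
      (fun z hz => by rw [det_fderiv_eq_jacobian]; exact hz.2)
  have h2 : MeasureTheory.volume (ρ '' s ∪ {0}) = 0 := by
    rw [MeasureTheory.measure_union_null_iff]
    exact ⟨h1, by simp⟩
  have h3 : (ρ '' s ∪ {0}) ≠ univ := by
    intro h
    rw [h] at h2
    simp at h2
  obtain ⟨ε, hε⟩ := (ne_univ_iff_exists_notMem _).1 h3
  exact ⟨ε, fun h => hε (Or.inr h), fun z hz hzε hJ => hε (Or.inl ⟨z, ⟨hz, hJ⟩, hzε⟩)⟩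

theorem exists_cutoff {K V : Set ℂ} (hK : IsClosed K) (hV : IsOpen V) (hKV : K ⊆ V) :
    ∃ χ : ℂ → ℝ, Differentiable ℝ χ ∧ (∀ z ∉ V, ∀ᶠ w in 𝓝 z, χ w = 0) ∧
      ∀ z ∈ K, ∀ᶠ w in 𝓝 z, χ w = 1 := by
  obtain ⟨χ, h0, h1, -⟩ := exists_contMDiffMap_zero_one_nhds_of_isClosed (n := 1)
    (modelWithCornersSelf ℝ ℂ) hV.isClosed_compl hK
    (disjoint_left.2 fun z hz hzK => hz (hKV hzK))
  refine ⟨χ, (χ.contMDiff.contDiff).differentiable (by simp), fun z hz => ?_, fun z hz => ?_⟩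
  · exact eventually_nhdsSet_iff_forall.1 h0 z hz
  · exact eventually_nhdsSet_iff_forall.1 h1 z hz

/-- A function without zeros near a compact set `K`, apart from a finite set `Q` of exceptional
points in the interior of `K`, agrees on `K` with a function on the plane that has finitely many
further exceptional points, all of them outside `K`. -/
theorem exists_extension {K U : Set ℂ} {Q : Finset ℂ} {g : ℂ → ℂ} (hK : IsCompact K)
    (hU : IsOpen U) (hQ : ↑Q ⊆ interior K) (hKU : K \ Q ⊆ U) (hg : DifferentiableOn ℝ g U)
    (h0 : ∀ z ∈ U, g z ≠ 0) :
    ∃ (G : ℂ → ℂ) (Z : Finset ℂ) (k : ℂ → ℤ), EqOn G g K ∧ (∀ z ∈ Z, z ∉ K) ∧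
      (∀ z ∉ Z, z ∉ Q → ContinuousAt G z ∧ G z ≠ 0) ∧ ∀ z ∈ Z, HasIndexAt G z (k z) := by
  obtain ⟨R, hR⟩ := hK.isBounded.subset_ball 0
  set V : Set ℂ := (U ∪ interior K) ∩ Metric.ball 0 R with hVdef
  have hV : IsOpen V := (hU.union isOpen_interior).inter Metric.isOpen_ball
  have hKV : K ⊆ V := fun z hz => by
    refine ⟨?_, hR hz⟩
    by_cases hzQ : z ∈ Q
    · exact Or.inr (hQ hzQ)
    · exact Or.inl (hKU ⟨hz, hzQ⟩)
  obtain ⟨χ, hχd, hχ0, hχ1⟩ := exists_cutoff hK.isClosed hV hKV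
  have hχd' : Differentiable ℝ (fun z => (χ z : ℂ)) := ofRealCLM.differentiable.comp hχd
  have hgd : ∀ z ∈ U, DifferentiableAt ℝ g z := fun z hz => hg.differentiableAt (hU.mem_nhds hz)
  -- At every point either g is differentiable, or the cutoff is locally 1, or it is locally 0.
  -- Points of Q fall under the second case, so the bad behaviour of g there never meets a varying
  -- cutoff.
  have hcases : ∀ z, z ∈ U ∨ z ∈ interior K ∨ ∀ᶠ w in 𝓝 z, χ w = 0 := by
    intro z
    by_cases hzV : z ∈ V
    · rcases hzV.1 with h | h
      · exact Or.inl h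
      · exact Or.inr (Or.inl h)
    · exact Or.inr (Or.inr (hχ0 z hzV))
  have hint1 : ∀ z ∈ interior K, ∀ᶠ w in 𝓝 z, χ w = 1 := fun z hz => hχ1 z (interior_subset hz)
  -- Where χ ≠ 1, the blend χg - (1 - χ)ε vanishes exactly when this quotient equals ε. A regular
  -- value of the quotient therefore makes the new zeros nondegenerate.
  let ρ : ℂ → ℂ := fun z => χ z / (1 - χ z) * g z
  have hρd : ∀ z ∈ {z | χ z ≠ 1}, DifferentiableAt ℝ ρ z := by
    intro z hz
    rcases hcases z with h | h | h
    · have h1 : DifferentiableAt ℝ (fun w => 1 - χ w) z := (differentiableAt_const _).sub (hχd z)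
      have hz1 : 1 - χ z ≠ 0 := sub_ne_zero.2 (Ne.symm hz)
      have h2 : DifferentiableAt ℝ (fun w => χ w / (1 - χ w)) z := by
        simp only [div_eq_mul_inv]
        exact (hχd z).fun_mul (h1.fun_inv hz1)
      have h3 : DifferentiableAt ℝ (fun w => ((χ w / (1 - χ w) : ℝ) : ℂ)) z :=
        ofRealCLM.differentiableAt.comp z h2
      simpa [ρ] using h3.fun_mul (hgd z h)
    · exact absurd (hint1 z h).self_of_nhds hz
    · refine (differentiableAt_const (0 : ℂ)).congr_of_eventuallyEq ?_
      filter_upwards [h] with w hw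
      simp [ρ, hw]
  obtain ⟨ε, hε0, hε⟩ := exists_regular_value hρd
  let G : ℂ → ℂ := fun z => χ z * g z - (1 - χ z) * ε
  have hG1 : ∀ z, χ z = 1 → G z = g z := fun z hz => by simp [G, hz]
  have hGρ : ∀ z, χ z ≠ 1 → G z = (ρ z - ε) * (1 - χ z) := by
    intro z hz
    have hz1 : (1 - χ z : ℂ) ≠ 0 := by
      rw [sub_ne_zero]
      exact_mod_cast (Ne.symm hz)
    simp only [G, ρ]
    field_simp
  have hopen : IsOpen {z | χ z ≠ 1} := isOpen_ne_fun hχd.continuous continuous_const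
  have hGc : ∀ z ∉ Q, ContinuousAt G z := by
    intro z hz
    have hU' : z ∈ U → ContinuousAt G z := fun h =>
      ((hχd' z).continuousAt.mul (hgd z h).continuousAt).sub
        ((continuousAt_const.sub (hχd' z).continuousAt).mul continuousAt_const)
    rcases hcases z with h | h | h
    · exact hU' h
    · exact hU' (hKU ⟨interior_subset h, hz⟩)
    · refine (continuousAt_const (y := -ε)).congr ?_
      filter_upwards [h] with w hw
      simp [G, hw]
  let Zs : Set ℂ := {z | χ z ≠ 1 ∧ ρ z = ε}
  have hGne : ∀ z ∉ Zs, z ∉ Q → G z ≠ 0 := by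
    intro z hz hzQ
    by_cases h1 : χ z = 1
    · rw [hG1 z h1]
      apply h0
      rcases hcases z with h | h | h
      · exact h
      · exact hKU ⟨interior_subset h, hzQ⟩
      · have := h.self_of_nhds
        rw [h1] at this
        norm_num at this
    · rw [hGρ z h1]
      refine mul_ne_zero (sub_ne_zero.2 fun h => hz ⟨h1, h⟩) ?_
      rw [sub_ne_zero]
      exact_mod_cast (Ne.symm h1)
  have hZ0 : ∀ z ∈ Zs, G z = 0 := fun z hz => by simp [hGρ z hz.1, hz.2]
  have hidx : ∀ z ∈ Zs, ∃ k : ℤ, HasIndexAt G z k := by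
    intro z hz
    have hJ := hε z hz.1 hz.2
    have hd : DifferentiableAt ℝ (fun w => ρ w - ε) z := (hρd z hz.1).sub_const ε
    have hc : ∀ᶠ w in 𝓝 z, ContinuousAt (fun w => ρ w - ε) w := by
      filter_upwards [hopen.mem_nhds hz.1] with w hw
      exact ((hρd w hw).sub_const ε).continuousAt
    have hJ' : jacobian (fun w => ρ w - ε) z = jacobian ρ z := by
      simp only [jacobian, dz, dzbar, fderiv_sub_const]
    have h1 : ∃ k : ℤ, HasIndexAt (fun w => ρ w - ε) z k := by
      rcases lt_or_gt_of_ne hJ with h | h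
      · exact ⟨-1, hasIndexAt_neg_one_of_jacobian_neg (by simp [hz.2]) hd hc (by rwa [hJ'])⟩
      · exact ⟨1, hasIndexAt_one_of_jacobian_pos (by simp [hz.2]) hd hc (by rwa [hJ'])⟩
    obtain ⟨k, hk⟩ := h1
    have h2 : HasIndexAt (fun w => (1 - χ w : ℂ)) z 0 := by
      refine hasIndexAt_zero_of_continuousAt ?_ (Eventually.of_forall fun w =>
        continuousAt_const.sub (hχd' w).continuousAt)
      rw [sub_ne_zero]
      exact_mod_cast (Ne.symm hz.1)
    have h3 := hk.mul h2
    rw [add_zero] at h3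
    refine ⟨k, h3.congr ?_⟩
    filter_upwards [nhdsWithin_le_nhds (hopen.mem_nhds hz.1)] with w hw using (hGρ w hw).symm
  -- The new zeros accumulate nowhere: not at one of themselves, which has an index; not at a point
  -- of Q, near which χ = 1; not elsewhere, where G is continuous and non-zero. Together with
  -- boundedness this gives finiteness.
  have hiso : ∀ x, ∀ᶠ w in 𝓝[≠] x, w ∉ Zs := by
    intro x
    by_cases hx : x ∈ Zs
    · obtain ⟨k, hk⟩ := hidx x hx
      filter_upwards [hk.eventually_ne_zero] with w hw hwZ using hw (hZ0 w hwZ)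
    · by_cases hxQ : x ∈ Q
      · filter_upwards [nhdsWithin_le_nhds (hint1 x (hQ hxQ))] with w hw hwZ using hwZ.1 hw
      · filter_upwards [nhdsWithin_le_nhds ((hGc x hxQ).eventually_ne (hGne x hx hxQ))] with
          w hw hwZ using hw (hZ0 w hwZ)
  have hbdd : Zs ⊆ Metric.closedBall 0 R := by
    intro z hz
    by_contra hzR
    have hzV : z ∉ V := fun h => hzR (Metric.ball_subset_closedBall h.2)
    have h2 := hz.2
    simp [ρ, (hχ0 z hzV).self_of_nhds] at h2
    exact hε0 h2.symm
  have hfin : Zs.Finite := by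
    by_contra hinf
    obtain ⟨x, -, hx⟩ := Set.Infinite.exists_accPt_of_subset_isCompact hinf
      (isCompact_closedBall (0 : ℂ) R) hbdd
    exact (accPt_iff_frequently_nhdsNE.1 hx) (hiso x)
  choose! k hk using hidx
  refine ⟨G, hfin.toFinset, k, fun z hz => hG1 z (hχ1 z hz).self_of_nhds, fun z hz hzK => ?_,
    fun z hz hzQ => ?_, fun z hz => hk z ?_⟩
  · exact ((hfin.mem_toFinset.1 hz).1) (hχ1 z hzK).self_of_nhds
  · rw [hfin.mem_toFinset] at hz
    exact ⟨hGc z hzQ, hGne z hz hzQ⟩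
  · exact hfin.mem_toFinset.1 hz

end HarmonicCount

/-! ### Wirtinger derivatives of harmonic maps and behaviour at poles -/

namespace HarmonicCount

open Set Complex InnerProductSpace

/-- For real harmonic u the function u_x - i·u_y is analytic. With f = u + iv, both functions here
are half of (u_x - i·u_y) ± i(v_x - i·v_y). -/
theorem analyticAt_dz_and_conj_dzbar {f : ℂ → ℂ} {z : ℂ} (hf : HarmonicAt f z) :
    AnalyticAt ℂ (dz f) z ∧ AnalyticAt ℂ (fun w => (starRingEnd ℂ) (dzbar f w)) z := by
  have hu := HarmonicAt.analyticAt_complex_partial (hf.comp_CLM reCLM)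
  have hv := HarmonicAt.analyticAt_complex_partial (hf.comp_CLM imCLM)
  have hd : ∀ᶠ w in 𝓝 z, DifferentiableAt ℝ f w := by
    filter_upwards [hf.eventually] with w hw using hw.1.differentiableAt two_ne_zero
  have hre : ∀ w, DifferentiableAt ℝ f w → ∀ v,
      fderiv ℝ (reCLM ∘ f) w v = (fderiv ℝ f w v).re := fun w hw v => by
    rw [fderiv_comp w reCLM.differentiableAt hw]; simp
  have him : ∀ w, DifferentiableAt ℝ f w → ∀ v,
      fderiv ℝ (imCLM ∘ f) w v = (fderiv ℝ f w v).im := fun w hw v => by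
    rw [fderiv_comp w imCLM.differentiableAt hw]; simp
  constructor
  · refine ((hu.add (analyticAt_const (v := I) |>.mul hv)).div (analyticAt_const (v := 2))
      two_ne_zero).congr ?_
    filter_upwards [hd] with w hw
    simp only [Pi.add_apply, Pi.mul_apply, Pi.div_apply, hre w hw, him w hw, dz]
    conv_rhs => rw [← re_add_im (fderiv ℝ f w 1), ← re_add_im (fderiv ℝ f w I)]
    ring
  · refine ((hu.sub (analyticAt_const (v := I) |>.mul hv)).div (analyticAt_const (v := 2))
      two_ne_zero).congr ?_
    filter_upwards [hd] with w hw
    simp only [Pi.sub_apply, Pi.mul_apply, Pi.div_apply, hre w hw, him w hw, dzbar]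
    conv_rhs => rw [← re_add_im (fderiv ℝ f w 1), ← re_add_im (fderiv ℝ f w I)]
    simp only [map_div₀, map_add, map_mul, conj_I, conj_ofReal, map_ofNat]
    ring

theorem jacobian_eq (f : ℂ → ℂ) (z : ℂ) :
    jacobian f z = ‖dz f z‖ ^ 2 - ‖(starRingEnd ℂ) (dzbar f z)‖ ^ 2 := by
  rw [norm_conj, jacobian]

theorem dz_dzbar_eq_of_hasFDerivAt {f : ℂ → ℂ} {D : ℂ →L[ℝ] ℂ} {z a b : ℂ}
    (hD : HasFDerivAt f D z) (h : ∀ v, D v = a * v + b * (starRingEnd ℂ) v) :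
    dz f z = a ∧ dzbar f z = b := by
  rw [dz, dzbar, hD.fderiv, h, h]
  simp only [map_one, conj_I]
  constructor
  · linear_combination (-a / 2 + b / 2) * I_mul_I
  · linear_combination (a / 2 - b / 2) * I_mul_I

theorem hasFDerivAt_log_norm_sub {z z₀ : ℂ} (h : z ≠ z₀) :
    ∃ D : ℂ →L[ℝ] ℂ, HasFDerivAt (fun w => (Real.log ‖w - z₀‖ : ℂ)) D z ∧
      ∀ v, D v = 1 / (2 * (z - z₀)) * v +
        1 / (2 * (starRingEnd ℂ) (z - z₀)) * (starRingEnd ℂ) v := by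
  have h0 : z - z₀ ≠ 0 := sub_ne_zero.2 h
  have h1 : HasFDerivAt (fun w : ℂ => ‖w - z₀‖ ^ 2) _ z :=
    ((hasFDerivAt_id (𝕜 := ℝ) z).sub_const z₀).norm_sq
  have h2 := (h1.log (by positivity)).const_mul (1 / 2 : ℝ)
  have h3 := ofRealCLM.hasFDerivAt.comp z h2
  refine ⟨_, h3.congr_of_eventuallyEq (Eventually.of_forall fun w => ?_), fun v => ?_⟩
  · simp
  · have hc : (starRingEnd ℂ) (z - z₀) ≠ 0 := (map_ne_zero _).2 h0
    have h4 : ((‖z - z₀‖ : ℂ)) ^ 2 = (z - z₀) * (starRingEnd ℂ) (z - z₀) := by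
      rw [mul_conj, normSq_eq_norm_sq]; push_cast; rfl
    have h5 : ((inner ℝ (z - z₀) v : ℝ) : ℂ) =
        ((starRingEnd ℂ) (z - z₀) * v + (z - z₀) * (starRingEnd ℂ) v) / 2 := by
      rw [Complex.inner, re_eq_add_conj]
      simp [mul_comm]
    change ((1 / 2 * ((‖z - z₀‖ ^ 2)⁻¹ * (2 • inner ℝ (z - z₀) v)) : ℝ) : ℂ) = _
    rw [nsmul_eq_mul]
    push_cast
    rw [h5, h4]
    field_simp

theorem dz_dzbar_of_pole_form {f H G : ℂ → ℂ} {z₀ c : ℂ} {n : ℕ} (hH : AnalyticAt ℂ H z₀)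
    (hG : AnalyticAt ℂ G z₀)
    (hf : ∀ᶠ z in 𝓝[≠] z₀, f z = H z / (z - z₀) ^ n + (starRingEnd ℂ) (G z / (z - z₀) ^ n)
        + c * (Real.log ‖z - z₀‖ : ℂ)) :
    ∀ᶠ z in 𝓝[≠] z₀,
      dz f z * (z - z₀) ^ (n + 1) = deriv H z * (z - z₀) - n * H z + c / 2 * (z - z₀) ^ n ∧
      (starRingEnd ℂ) (dzbar f z) * (z - z₀) ^ (n + 1) =
        deriv G z * (z - z₀) - n * G z + (starRingEnd ℂ) c / 2 * (z - z₀) ^ n := by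
  have hq : ∀ F : ℂ → ℂ, ∀ z, DifferentiableAt ℂ F z → z - z₀ ≠ 0 →
      HasDerivAt (fun w => F w / (w - z₀) ^ n)
        ((deriv F z * (z - z₀) - n * F z) / (z - z₀) ^ (n + 1)) z := by
    intro F z hF hz
    have h1 := ((hasDerivAt_id z).sub_const z₀).pow n
    have h2 := hF.hasDerivAt.div h1 (pow_ne_zero n hz)
    refine h2.congr_deriv ?_
    rcases n with _ | n
    · simp [hz]
    · simp
      field_simp
      ring
  have hHd : ∀ᶠ z in 𝓝[≠] z₀, DifferentiableAt ℂ H z :=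
    (hH.eventually_analyticAt.mono fun z hz => hz.differentiableAt).filter_mono nhdsWithin_le_nhds
  have hGd : ∀ᶠ z in 𝓝[≠] z₀, DifferentiableAt ℂ G z :=
    (hG.eventually_analyticAt.mono fun z hz => hz.differentiableAt).filter_mono nhdsWithin_le_nhds
  have hf' := eventually_eventually_nhdsWithin.2 hf
  filter_upwards [hHd, hGd, hf', self_mem_nhdsWithin] with z hHz hGz hfz hne
  have hz : z - z₀ ≠ 0 := sub_ne_zero.2 hne
  have hfz' : f =ᶠ[𝓝 z] fun z => H z / (z - z₀) ^ n + (starRingEnd ℂ) (G z / (z - z₀) ^ n)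
        + c * (Real.log ‖z - z₀‖ : ℂ) := by
    rwa [nhdsWithin_eq_nhds.2 (isOpen_compl_singleton.mem_nhds hne)] at hfz
  obtain ⟨D, hD, hDv⟩ := hasFDerivAt_log_norm_sub hne
  have h1 := (hq H z hHz hz).hasFDerivAt.restrictScalars ℝ
  have h2 := conjCLE.toContinuousLinearMap.hasFDerivAt.comp z
    ((hq G z hGz hz).hasFDerivAt.restrictScalars ℝ)
  have h3 := ((h1.add h2).add (hD.const_mul c)).congr_of_eventuallyEq hfz'
  obtain ⟨ha, hb⟩ := dz_dzbar_eq_of_hasFDerivAt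
    (a := (deriv H z * (z - z₀) - n * H z) / (z - z₀) ^ (n + 1) + c * (1 / (2 * (z - z₀))))
    (b := (starRingEnd ℂ) ((deriv G z * (z - z₀) - n * G z) / (z - z₀) ^ (n + 1)) +
      c * (1 / (2 * (starRingEnd ℂ) (z - z₀)))) h3 (fun v => by
      simp [hDv]
      ring)
  rw [ha, hb]
  constructor
  · field_simp
    ring
  · simp only [map_add, map_mul, map_div₀, conj_conj, map_one, map_ofNat]
    field_simp
    ring

/-- Multiplied by (z - z₀)^(n+1), the derivative ∂f/∂z and the conjugate of ∂f/∂z̄ tend to -n·H(z₀)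
and -n·G(z₀). The logarithm contributes only a multiple of (z - z₀)^n, which vanishes in the limit
since n ≥ 1. -/
theorem jacobian_near_pole {f H G : ℂ → ℂ} {z₀ c : ℂ} {n : ℕ} (hn : 1 ≤ n)
    (hH : AnalyticAt ℂ H z₀) (hG : AnalyticAt ℂ G z₀)
    (hf : ∀ᶠ z in 𝓝[≠] z₀, f z = H z / (z - z₀) ^ n + (starRingEnd ℂ) (G z / (z - z₀) ^ n)
        + c * (Real.log ‖z - z₀‖ : ℂ)) :
    (‖G z₀‖ < ‖H z₀‖ → ∀ᶠ z in 𝓝[≠] z₀, 0 < jacobian f z) ∧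
    (‖H z₀‖ < ‖G z₀‖ → ∀ᶠ z in 𝓝[≠] z₀, jacobian f z < 0) := by
  have hlim : ∀ (F : ℂ → ℂ) (d : ℂ), AnalyticAt ℂ F z₀ →
      Tendsto (fun z => ‖deriv F z * (z - z₀) - n * F z + d / 2 * (z - z₀) ^ n‖) (𝓝[≠] z₀)
        (𝓝 (n * ‖F z₀‖)) := by
    intro F d hF
    have h1 : ContinuousAt (fun z => ‖deriv F z * (z - z₀) - n * F z + d / 2 * (z - z₀) ^ n‖)
        z₀ := by
      have := hF.deriv.continuousAt
      have := hF.continuousAt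
      fun_prop
    have h2 := h1.tendsto
    simp only [sub_self, mul_zero, zero_sub, zero_pow (by omega : n ≠ 0), add_zero, norm_neg,
      norm_mul, norm_natCast] at h2
    exact h2.mono_left nhdsWithin_le_nhds
  have hev := dz_dzbar_of_pole_form hH hG hf
  have hn' : (0 : ℝ) < n := by exact_mod_cast hn
  constructor
  · intro hlt
    have h1 := (hlim G ((starRingEnd ℂ) c) hG).eventually_lt (hlim H c hH)
      (mul_lt_mul_of_pos_left hlt hn')
    filter_upwards [hev, h1, self_mem_nhdsWithin] with z hz hlt hne
    rw [← hz.1, ← hz.2, norm_mul, norm_mul] at hlt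
    have h3 := lt_of_mul_lt_mul_right hlt (norm_nonneg _)
    rw [jacobian_eq, sub_pos]
    exact pow_lt_pow_left₀ h3 (norm_nonneg _) two_ne_zero
  · intro hlt
    have h1 := (hlim H c hH).eventually_lt (hlim G ((starRingEnd ℂ) c) hG)
      (mul_lt_mul_of_pos_left hlt hn')
    filter_upwards [hev, h1, self_mem_nhdsWithin] with z hz hlt hne
    rw [← hz.1, ← hz.2, norm_mul, norm_mul] at hlt
    have h3 := lt_of_mul_lt_mul_right hlt (norm_nonneg _)
    rw [jacobian_eq, sub_neg]
    exact pow_lt_pow_left₀ h3 (norm_nonneg _) two_ne_zero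

theorem tendsto_log_norm_mul_pow (z₀ c : ℂ) {n : ℕ} (hn : 1 ≤ n) :
    Tendsto (fun z => ‖c * (Real.log ‖z - z₀‖ : ℂ)‖ * ‖z - z₀‖ ^ n) (𝓝 z₀) (𝓝 0) := by
  obtain ⟨m, rfl⟩ := Nat.exists_eq_add_of_le' hn
  have h1 : Continuous fun z : ℂ => ‖c‖ * (|‖z - z₀‖ * Real.log ‖z - z₀‖| * ‖z - z₀‖ ^ m) :=
    continuous_const.mul (((Real.continuous_mul_log.comp
      (continuous_id.sub continuous_const).norm).abs).mul
        ((continuous_id.sub continuous_const).norm.pow m))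
  have h2 := h1.tendsto z₀
  simp only [sub_self, norm_zero, zero_mul, abs_zero, mul_zero] at h2
  refine h2.congr fun z => ?_
  rw [norm_mul, norm_real, Real.norm_eq_abs, abs_mul, abs_norm]
  ring

/-- The larger of the two leading terms dominates: after multiplication by |z - z₀|^n the rest of f
tends in norm to at most the smaller leading coefficient. Conjugation reverses orientation, which
turns index -n into n. -/
theorem hasIndexAt_pole {f H G : ℂ → ℂ} {z₀ c : ℂ} {n : ℕ} (hn : 1 ≤ n)
    (hfc : ∀ᶠ z in 𝓝[≠] z₀, ContinuousAt f z)
    (hH : AnalyticAt ℂ H z₀) (hG : AnalyticAt ℂ G z₀)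
    (hf : ∀ᶠ z in 𝓝[≠] z₀, f z = H z / (z - z₀) ^ n + (starRingEnd ℂ) (G z / (z - z₀) ^ n)
        + c * (Real.log ‖z - z₀‖ : ℂ)) :
    (‖G z₀‖ < ‖H z₀‖ → HasIndexAt f z₀ (-n)) ∧ (‖H z₀‖ < ‖G z₀‖ → HasIndexAt f z₀ n) := by
  have hlim : ∀ F₁ F₂ : ℂ → ℂ, AnalyticAt ℂ F₁ z₀ → AnalyticAt ℂ F₂ z₀ →
      Tendsto (fun z => ‖F₁ z - F₁ z₀‖ + ‖F₂ z‖ + ‖c * (Real.log ‖z - z₀‖ : ℂ)‖ * ‖z - z₀‖ ^ n)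
        (𝓝[≠] z₀) (𝓝 ‖F₂ z₀‖) := by
    intro F₁ F₂ h1 h2
    have h3 : ContinuousAt (fun z => ‖F₁ z - F₁ z₀‖ + ‖F₂ z‖) z₀ := by
      have := h1.continuousAt
      have := h2.continuousAt
      fun_prop
    have h4 := h3.tendsto.add (tendsto_log_norm_mul_pow z₀ c hn)
    simp only [sub_self, norm_zero, zero_add, add_zero] at h4
    exact h4.mono_left nhdsWithin_le_nhds
  constructor
  · intro hlt
    have hm : HasIndexAt (fun w => H z₀ * (w - z₀) ^ (-n : ℤ)) z₀ (-n) := by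
      have := (hasIndexAt_const (norm_pos_iff.1 ((norm_nonneg _).trans_lt hlt)) z₀).mul
        (hasIndexAt_zpow z₀ (-n))
      rwa [zero_add] at this
    refine hm.of_norm_sub_lt hfc ?_
    filter_upwards [hf, (hlim H G hH hG).eventually_lt_const hlt, self_mem_nhdsWithin] with
      z hz hlt' hne
    have hz0 : z - z₀ ≠ 0 := sub_ne_zero.2 hne
    have hpos : 0 < ‖z - z₀‖ ^ n := pow_pos (norm_pos_iff.2 hz0) n
    rw [zpow_neg, zpow_natCast, ← div_eq_mul_inv, norm_div, norm_pow, lt_div_iff₀ hpos, hz]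
    refine lt_of_le_of_lt ?_ hlt'
    calc _ = ‖(H z - H z₀) / (z - z₀) ^ n + (starRingEnd ℂ) (G z / (z - z₀) ^ n) +
            c * (Real.log ‖z - z₀‖ : ℂ)‖ * ‖z - z₀‖ ^ n := by congr 2; ring
      _ ≤ (‖H z - H z₀‖ / ‖z - z₀‖ ^ n + ‖G z‖ / ‖z - z₀‖ ^ n +
            ‖c * (Real.log ‖z - z₀‖ : ℂ)‖) * ‖z - z₀‖ ^ n := by
          refine mul_le_mul_of_nonneg_right ((norm_add₃_le).trans_eq ?_) hpos.le
          rw [norm_conj, norm_div, norm_div, norm_pow]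
      _ = _ := by field_simp
  · intro hlt
    have hm : HasIndexAt (fun w => (starRingEnd ℂ) (G z₀) * (starRingEnd ℂ) ((w - z₀) ^ (-n : ℤ)))
        z₀ n := by
      have := (hasIndexAt_const (c := (starRingEnd ℂ) (G z₀)) (by
        rw [← norm_pos_iff, norm_conj]; exact (norm_nonneg _).trans_lt hlt) z₀).mul
        (hasIndexAt_conj_zpow z₀ (-n))
      rwa [zero_add, neg_neg] at this
    refine hm.of_norm_sub_lt hfc ?_
    filter_upwards [hf, (hlim G H hG hH).eventually_lt_const hlt, self_mem_nhdsWithin] with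
      z hz hlt' hne
    have hz0 : z - z₀ ≠ 0 := sub_ne_zero.2 hne
    have hpos : 0 < ‖z - z₀‖ ^ n := pow_pos (norm_pos_iff.2 hz0) n
    rw [← map_mul, zpow_neg, zpow_natCast, ← div_eq_mul_inv, norm_conj, norm_div, norm_pow,
      lt_div_iff₀ hpos, hz]
    refine lt_of_le_of_lt ?_ hlt'
    calc _ = ‖(starRingEnd ℂ) ((G z - G z₀) / (z - z₀) ^ n) + H z / (z - z₀) ^ n +
            c * (Real.log ‖z - z₀‖ : ℂ)‖ * ‖z - z₀‖ ^ n := by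
          congr 2
          simp only [map_div₀, map_sub]
          ring
      _ ≤ (‖G z - G z₀‖ / ‖z - z₀‖ ^ n + ‖H z‖ / ‖z - z₀‖ ^ n +
            ‖c * (Real.log ‖z - z₀‖ : ℂ)‖) * ‖z - z₀‖ ^ n := by
          refine mul_le_mul_of_nonneg_right ((norm_add₃_le).trans_eq ?_) hpos.le
          rw [norm_conj, norm_div, norm_div, norm_pow]
      _ = _ := by field_simp

end HarmonicCount

/-! ### Critical set, tiles and the dilatation at regular critical points -/

namespace HarmonicCount

open Set Complex InnerProductSpace

variable {f : ℂ → ℂ} {S : Finset ℂ}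

theorem isOpen_notMem_finset (S : Finset ℂ) : IsOpen {z : ℂ | z ∉ S} :=
  S.finite_toSet.isClosed.isOpen_compl

theorem isPreconnected_notMem_finset (S : Finset ℂ) : IsPreconnected {z : ℂ | z ∉ S} :=
  (Set.Countable.isConnected_compl_of_one_lt_rank (E := ℂ) (by simp)
    S.finite_toSet.countable).isPreconnected

theorem eventually_notMem_finset (S : Finset ℂ) (z : ℂ) : ∀ᶠ w in 𝓝[≠] z, w ∉ S := by
  have h : ∀ᶠ w in 𝓝 z, w ∉ S.erase z := (isOpen_notMem_finset _).mem_nhds (by simp)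
  filter_upwards [nhdsWithin_le_nhds h, self_mem_nhdsWithin] with w hw hne hwS
  exact hw (Finset.mem_erase.2 ⟨hne, hwS⟩)

theorem NonDegenerate.differentiableAt (hf : NonDegenerate f S) {z : ℂ} (hz : z ∉ S) :
    DifferentiableAt ℝ f z :=
  (hf.harmonic z hz).1.differentiableAt two_ne_zero

theorem NonDegenerate.continuousAt (hf : NonDegenerate f S) {z : ℂ} (hz : z ∉ S) :
    ContinuousAt f z :=
  (hf.differentiableAt hz).continuousAt

theorem NonDegenerate.analyticOnNhd_dz (hf : NonDegenerate f S) :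
    AnalyticOnNhd ℂ (dz f) {z | z ∉ S} :=
  fun z hz => (analyticAt_dz_and_conj_dzbar (hf.harmonic z hz)).1

theorem NonDegenerate.analyticOnNhd_conj_dzbar (hf : NonDegenerate f S) :
    AnalyticOnNhd ℂ (fun z => (starRingEnd ℂ) (dzbar f z)) {z | z ∉ S} :=
  fun z hz => (analyticAt_dz_and_conj_dzbar (hf.harmonic z hz)).2

theorem NonDegenerate.continuousAt_jacobian (hf : NonDegenerate f S) {z : ℂ} (hz : z ∉ S) :
    ContinuousAt (jacobian f) z := by
  have h1 := (hf.analyticOnNhd_dz z hz).continuousAt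
  have h2 := (hf.analyticOnNhd_conj_dzbar z hz).continuousAt
  have h3 : jacobian f = fun z => ‖dz f z‖ ^ 2 - ‖(starRingEnd ℂ) (dzbar f z)‖ ^ 2 :=
    funext (jacobian_eq f)
  rw [h3]
  exact (h1.norm.pow 2).sub (h2.norm.pow 2)

/-- The sign of the Jacobian near a pole determines the sign of the index. -/
theorem NonDegenerate.exists_index_pole (hf : NonDegenerate f S) {z₀ : ℂ} (hz₀ : z₀ ∈ S) :
    ∃ n : ℕ, ((∀ᶠ z in 𝓝[≠] z₀, 0 < jacobian f z) ∧ HasIndexAt f z₀ (-n)) ∨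
      ((∀ᶠ z in 𝓝[≠] z₀, jacobian f z < 0) ∧ HasIndexAt f z₀ n) := by
  obtain ⟨n, H, G, c, hn, hH, hG, hne, hform⟩ := hf.pole_form z₀ hz₀
  have hc : ∀ᶠ z in 𝓝[≠] z₀, ContinuousAt f z := by
    filter_upwards [eventually_notMem_finset S z₀] with z hz using hf.continuousAt hz
  have h1 := jacobian_near_pole hn hH hG hform
  have h2 := hasIndexAt_pole hn hc hH hG hform
  rcases lt_or_gt_of_ne hne with h | h
  · exact ⟨n, Or.inr ⟨h1.2 h, h2.2 h⟩⟩
  · exact ⟨n, Or.inl ⟨h1.1 h, h2.1 h⟩⟩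

/-- Since f tends to infinity at z₀, the constant η is a relatively small perturbation. -/
theorem NonDegenerate.hasIndexAt_sub_pole (hf : NonDegenerate f S) {z₀ : ℂ} (hz₀ : z₀ ∈ S) {k : ℤ}
    (hk : HasIndexAt f z₀ k) (η : ℂ) : HasIndexAt (fun z => f z - η) z₀ k := by
  refine hk.of_norm_sub_lt ?_ ?_
  · filter_upwards [eventually_notMem_finset S z₀] with z hz
      using (hf.continuousAt hz).sub continuousAt_const
  · have h := (tendsto_norm_cobounded_atTop.comp (hf.pole z₀ hz₀)).eventually_gt_atTop ‖η‖
    filter_upwards [h] with z hz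
    simpa using hz

theorem NonDegenerate.eventually_sign (hf : NonDegenerate f S) {z : ℂ} (hz : z ∉ critSet f S) :
    (∀ᶠ w in 𝓝[≠] z, 0 < jacobian f w) ∨ ∀ᶠ w in 𝓝[≠] z, jacobian f w < 0 := by
  by_cases hzS : z ∈ S
  · obtain ⟨n, h | h⟩ := hf.exists_index_pole hzS
    · exact Or.inl h.1
    · exact Or.inr h.1
  · have hJ : jacobian f z ≠ 0 := fun h => hz ⟨hzS, h⟩
    rcases lt_or_gt_of_ne hJ with h | h
    · exact Or.inr (nhdsWithin_le_nhds ((hf.continuousAt_jacobian hzS).eventually_lt_const h))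
    · exact Or.inl (nhdsWithin_le_nhds ((hf.continuousAt_jacobian hzS).eventually_const_lt h))

/-- The point at issue is a pole: critical points cannot accumulate there, because the Jacobian has
a strict sign around it. -/
theorem NonDegenerate.isClosed_critSet (hf : NonDegenerate f S) : IsClosed (critSet f S) := by
  rw [← isOpen_compl_iff, isOpen_iff_eventually]
  intro z hz
  have h : ∀ᶠ w in 𝓝[≠] z, w ∈ (critSet f S)ᶜ := by
    rcases hf.eventually_sign hz with h | h
    · filter_upwards [h] with w hw hwC using hw.ne' hwC.2
    · filter_upwards [h] with w hw hwC using hw.ne hwC.2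
  rw [eventually_nhdsWithin_iff] at h
  filter_upwards [h] with w hw
  by_cases hwz : w = z
  · rwa [hwz]
  · exact hw hwz

theorem NonDegenerate.isCompact_critSet (hf : NonDegenerate f S) : IsCompact (critSet f S) := by
  refine Metric.isCompact_of_isClosed_isBounded hf.isClosed_critSet ?_
  rw [← Bornology.isCobounded_compl_iff, Bornology.isCobounded_def]
  filter_upwards [hf.sense_preserving_infty] with z hz hzC using hz.ne' hzC.2

theorem IsTile.isOpen (hf : NonDegenerate f S) {A : Set ℂ} (hA : IsTile f S A) : IsOpen A := by
  obtain ⟨z, -, rfl⟩ := hA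
  exact hf.isClosed_critSet.isOpen_compl.connectedComponentIn

theorem IsTile.isPreconnected {A : Set ℂ} (hA : IsTile f S A) : IsPreconnected A := by
  obtain ⟨z, -, rfl⟩ := hA
  exact isPreconnected_connectedComponentIn

theorem IsTile.notMem_critSet {A : Set ℂ} (hA : IsTile f S A) {z : ℂ} (hz : z ∈ A) :
    z ∉ critSet f S := by
  obtain ⟨w, -, rfl⟩ := hA
  exact connectedComponentIn_subset _ _ hz

/-- A connected set without critical points that meets a tile is contained in it. -/
theorem IsTile.subset_of_inter_nonempty {A B : Set ℂ} (hA : IsTile f S A) (hB : IsPreconnected B)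
    (hBC : ∀ z ∈ B, z ∉ critSet f S) (hAB : (A ∩ B).Nonempty) : B ⊆ A := by
  obtain ⟨w, hw, rfl⟩ := hA
  obtain ⟨z, hzA, hzB⟩ := hAB
  rw [connectedComponentIn_eq hzA]
  exact hB.subset_connectedComponentIn hzB hBC

/-- A ball free of critical points that meets A lies in A, so its centre cannot be a boundary point.
-/
theorem IsTile.frontier_subset (hf : NonDegenerate f S) {A : Set ℂ} (hA : IsTile f S A) :
    frontier A ⊆ critSet f S := by
  intro z hz
  by_contra hzC
  obtain ⟨r, hr, hball⟩ := Metric.isOpen_iff.1 hf.isClosed_critSet.isOpen_compl z hzC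
  have hcl : z ∈ closure A := frontier_subset_closure hz
  obtain ⟨w, hw, hwA⟩ := mem_closure_iff.1 hcl _ Metric.isOpen_ball (Metric.mem_ball_self hr)
  have hsub : Metric.ball z r ⊆ A := hA.subset_of_inter_nonempty
    (convex_ball z r).isPreconnected (fun w hw => hball hw) ⟨w, hwA, hw⟩
  rw [(hA.isOpen hf).frontier_eq] at hz
  exact hz.2 (hsub (Metric.mem_ball_self hr))

/-- The Jacobian has constant sign on a tile. -/
theorem IsTile.exists_sign (hf : NonDegenerate f S) {A : Set ℂ} (hA : IsTile f S A) :
    (∀ z ∈ A, ∀ᶠ w in 𝓝[≠] z, 0 < jacobian f w) ∨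
      ∀ z ∈ A, ∀ᶠ w in 𝓝[≠] z, jacobian f w < 0 := by
  -- Punctured neighborhoods let poles in A take part in the connectedness argument although f
  -- carries no information at them.
  have hop : ∀ p : ℂ → Prop, IsOpen {z | ∀ᶠ w in 𝓝[≠] z, p w} := by
    intro p
    rw [isOpen_iff_eventually]
    intro z hz
    have h1 : ∀ᶠ y in 𝓝[≠] z, ∀ᶠ w in 𝓝[≠] y, p w := by
      have h2 := eventually_eventually_nhdsWithin.2 hz
      filter_upwards [h2, self_mem_nhdsWithin] with y hy hne
      rw [nhdsWithin_eq_nhds.2 (isOpen_compl_singleton.mem_nhds hne)] at hy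
      exact nhdsWithin_le_nhds hy
    rw [eventually_nhdsWithin_iff] at h1
    filter_upwards [h1] with y hy
    by_cases hyz : y = z
    · rwa [hyz]
    · exact hy hyz
  have hcov : A ⊆ {z | ∀ᶠ w in 𝓝[≠] z, 0 < jacobian f w} ∪
      {z | ∀ᶠ w in 𝓝[≠] z, jacobian f w < 0} :=
    fun z hz => hf.eventually_sign (hA.notMem_critSet hz)
  have hdisj : A ∩ ({z | ∀ᶠ w in 𝓝[≠] z, 0 < jacobian f w} ∩
      {z | ∀ᶠ w in 𝓝[≠] z, jacobian f w < 0}) = ∅ := by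
    rw [eq_empty_iff_forall_notMem]
    rintro z ⟨-, h1, h2⟩
    rw [mem_ofPred_eq] at h1 h2
    obtain ⟨w, hw1, hw2⟩ := (h1.and h2).exists
    linarith
  rcases (isPreconnected_iff_subset_of_disjoint.1 hA.isPreconnected) _ _ (hop _) (hop _) hcov
    hdisj with h | h
  · exact Or.inl h
  · exact Or.inr h

theorem IsTile.jacobian_pos (hf : NonDegenerate f S) {A : Set ℂ} (hA : IsTile f S A)
    (hs : ∀ z ∈ A, ∀ᶠ w in 𝓝[≠] z, 0 < jacobian f w) {z : ℂ} (hz : z ∈ A) (hzS : z ∉ S) :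
    0 < jacobian f z := by
  by_contra! h
  have hne : jacobian f z ≠ 0 := fun h => hA.notMem_critSet hz ⟨hzS, h⟩
  have h1 := (hf.continuousAt_jacobian hzS).eventually_lt_const (lt_of_le_of_ne h hne)
  obtain ⟨w, hw1, hw2⟩ := ((hs z hz).and (nhdsWithin_le_nhds h1)).exists
  linarith

theorem IsTile.jacobian_neg (hf : NonDegenerate f S) {A : Set ℂ} (hA : IsTile f S A)
    (hs : ∀ z ∈ A, ∀ᶠ w in 𝓝[≠] z, jacobian f w < 0) {z : ℂ} (hz : z ∈ A) (hzS : z ∉ S) :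
    jacobian f z < 0 := by
  by_contra! h
  have hne : jacobian f z ≠ 0 := fun h => hA.notMem_critSet hz ⟨hzS, h⟩
  have h1 := (hf.continuousAt_jacobian hzS).eventually_const_lt (lt_of_le_of_ne h hne.symm)
  obtain ⟨w, hw1, hw2⟩ := ((hs z hz).and (nhdsWithin_le_nhds h1)).exists
  linarith

theorem finite_zeros_of_analyticOnNhd {F : ℂ → ℂ} {U K : Set ℂ} (hF : AnalyticOnNhd ℂ F U)
    (hU : IsPreconnected U) (hK : IsCompact K) (hKU : K ⊆ U) (hne : ∃ z ∈ U, F z ≠ 0) :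
    {z ∈ K | F z = 0}.Finite := by
  by_contra hinf
  obtain ⟨x, hxK, hx⟩ := Set.Infinite.exists_accPt_of_subset_isCompact hinf hK (sep_subset _ _)
  have h1 : ∃ᶠ z in 𝓝[≠] x, F z = 0 :=
    (accPt_iff_frequently_nhdsNE.1 hx).mono fun z hz => hz.2
  obtain ⟨z, hzU, hz⟩ := hne
  exact hz (hF.eqOn_zero_of_preconnected_of_frequently_eq_zero hU (hKU hxK) h1 hzU)

/-- The critical points at which `∂f/∂z` or the derivative of the dilatation (up to the factor
`(∂f/∂z)²`) vanishes. -/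
def singularSet (f : ℂ → ℂ) (S : Finset ℂ) : Set ℂ :=
  {z ∈ critSet f S | dz f z = 0 ∨ deriv (fun z => (starRingEnd ℂ) (dzbar f z)) z * dz f z -
    (starRingEnd ℂ) (dzbar f z) * deriv (dz f) z = 0}

theorem NonDegenerate.exists_jacobian_pos (hf : NonDegenerate f S) :
    ∃ z ∉ S, 0 < jacobian f z := by
  have h : ∀ᶠ z in Bornology.cobounded ℂ, z ∉ S :=
    (Bornology.isBounded_def.1 S.finite_toSet.isBounded)
  obtain ⟨z, hz1, hz2⟩ := (h.and hf.sense_preserving_infty).exists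
  exact ⟨z, hz1, hz2⟩

/-- Singular points are zeros, in the compact critical set, of two analytic functions: ∂f/∂z and the
numerator W of ω'. The identity theorem gives finiteness unless one vanishes identically; positivity
of the Jacobian near infinity handles the degenerate case. -/
theorem NonDegenerate.finite_singularSet (hf : NonDegenerate f S) : (singularSet f S).Finite := by
  set h := dz f with hh
  set k := fun z => (starRingEnd ℂ) (dzbar f z) with hk
  have hU := isPreconnected_notMem_finset S
  have hUo := isOpen_notMem_finset S
  have hha : AnalyticOnNhd ℂ h {z | z ∉ S} := hf.analyticOnNhd_dz
  have hka : AnalyticOnNhd ℂ k {z | z ∉ S} := hf.analyticOnNhd_conj_dzbar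
  have hCU : critSet f S ⊆ {z | z ∉ S} := fun z hz => hz.1
  obtain ⟨z₁, hz₁, hJ₁⟩ := hf.exists_jacobian_pos
  have hne : h z₁ ≠ 0 := by
    intro h0
    have h1 := jacobian_eq f z₁
    rw [← hh, h0] at h1
    simp at h1
    nlinarith [sq_nonneg ‖dzbar f z₁‖]
  have hfin1 := finite_zeros_of_analyticOnNhd hha hU hf.isCompact_critSet hCU ⟨z₁, hz₁, hne⟩
  let W : ℂ → ℂ := fun z => deriv k z * h z - k z * deriv h z
  have hWa : AnalyticOnNhd ℂ W {z | z ∉ S} := (hka.deriv.mul hha).sub (hka.mul hha.deriv)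
  by_cases hW : ∃ z ∈ {z | z ∉ S}, W z ≠ 0
  · have hfin2 := finite_zeros_of_analyticOnNhd hWa hU hf.isCompact_critSet hCU hW
    refine (hfin1.union hfin2).subset ?_
    rintro z ⟨hzC, hz | hz⟩
    · exact Or.inl ⟨hzC, hz⟩
    · exact Or.inr ⟨hzC, hz⟩
  -- If W ≡ 0 then ω is locally constant near a critical point with ∂f/∂z ≠ 0, and the constant has
  -- modulus 1. By the identity theorem the relation spreads to the complement of S and makes the
  -- Jacobian vanish at z₁. Hence every critical point is a zero of ∂f/∂z.
  · push Not at hW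
    refine hfin1.subset ?_
    rintro z ⟨hzC, -⟩
    refine ⟨hzC, ?_⟩
    by_contra hz0
    have hev : ∀ᶠ w in 𝓝 z, w ∉ S ∧ h w ≠ 0 :=
      (hUo.eventually_mem hzC.1).and ((hha z hzC.1).continuousAt.eventually_ne hz0)
    obtain ⟨r, hr, hball⟩ := Metric.eventually_nhds_iff_ball.1 hev
    have hd : ∀ w ∈ Metric.ball z r, HasDerivAt (fun w => k w / h w) 0 w := by
      intro w hw
      have h1 := (hka w (hball w hw).1).differentiableAt.hasDerivAt.div
        (hha w (hball w hw).1).differentiableAt.hasDerivAt (hball w hw).2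
      have h2 : deriv k w * h w - k w * deriv h w = 0 := hW w (hball w hw).1
      rw [h2, zero_div] at h1
      exact h1
    have hconst : ∀ w ∈ Metric.ball z r, k w - k z / h z * h w = 0 := by
      intro w hw
      have h1 := Metric.isOpen_ball.is_const_of_deriv_eq_zero (convex_ball z r).isPreconnected
        (fun w hw => (hd w hw).differentiableAt.differentiableWithinAt)
        (fun w hw => (hd w hw).deriv) hw (Metric.mem_ball_self hr)
      rw [← h1, div_mul_cancel₀ _ (hball w hw).2, sub_self]
    have hglob : EqOn (fun w => k w - k z / h z * h w) 0 {z | z ∉ S} :=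
      (hka.sub (analyticOnNhd_const.mul hha)).eqOn_zero_of_preconnected_of_eventuallyEq_zero hU
        hzC.1 (by filter_upwards [Metric.ball_mem_nhds z hr] with w hw using hconst w hw)
    have hc : ‖k z / h z‖ = 1 := by
      have h1 := hzC.2
      rw [jacobian_eq, sub_eq_zero] at h1
      have h2 : ‖h z‖ = ‖k z‖ := (pow_left_inj₀ (norm_nonneg _) (norm_nonneg _) two_ne_zero).1 h1
      rw [norm_div, ← h2, div_self (norm_ne_zero_iff.2 hz0)]
    have h3 : k z₁ = k z / h z * h z₁ := sub_eq_zero.1 (hglob hz₁)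
    have h4 : ‖k z₁‖ = ‖h z₁‖ := by rw [h3, norm_mul, hc, one_mul]
    rw [jacobian_eq] at hJ₁
    simp only [hk, hh] at h4
    rw [h4] at hJ₁
    linarith

theorem dilatation_eq_of_continuousAt {z : ℂ}
    (h : ContinuousAt (fun w => (starRingEnd ℂ) (dzbar f w) / dz f w) z) :
    dilatation f z = (starRingEnd ℂ) (dzbar f z) / dz f z := by
  have ht : Tendsto (fun w => (starRingEnd ℂ) (dzbar f w) / dz f w) (𝓝[≠] z)
      (𝓝 ((starRingEnd ℂ) (dzbar f z) / dz f z)) := h.tendsto.mono_left nhdsWithin_le_nhds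
  have hex : ∃ w : ℂ, Tendsto (fun ζ => (starRingEnd ℂ) (dzbar f ζ) / dz f ζ) (𝓝[≠] z) (𝓝 w) :=
    ⟨_, ht⟩
  rw [dilatation, dif_pos hex]
  exact tendsto_nhds_unique hex.choose_spec ht

/-- Local description of the dilatation at a non-singular critical point. -/
theorem NonDegenerate.dilatation_regular (hf : NonDegenerate f S) {z : ℂ} (hz : z ∈ critSet f S)
    (hzs : z ∉ singularSet f S) :
    AnalyticAt ℂ (dilatation f) z ∧ deriv (dilatation f) z ≠ 0 ∧ ‖dilatation f z‖ = 1 ∧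
      ∀ᶠ w in 𝓝 z, w ∉ S ∧ (0 < jacobian f w ↔ ‖dilatation f w‖ < 1) ∧
        (jacobian f w < 0 ↔ 1 < ‖dilatation f w‖) := by
  have hha := hf.analyticOnNhd_dz
  have hka := hf.analyticOnNhd_conj_dzbar
  have hz0 : dz f z ≠ 0 := fun h => hzs ⟨hz, Or.inl h⟩
  have hzW : deriv (fun z => (starRingEnd ℂ) (dzbar f z)) z * dz f z -
      (starRingEnd ℂ) (dzbar f z) * deriv (dz f) z ≠ 0 := fun h => hzs ⟨hz, Or.inr h⟩
  have hev : ∀ᶠ w in 𝓝 z, w ∉ S ∧ dz f w ≠ 0 :=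
    ((isOpen_notMem_finset S).eventually_mem hz.1).and
      ((hha z hz.1).continuousAt.eventually_ne hz0)
  have hω : ∀ᶠ w in 𝓝 z, dilatation f w = (starRingEnd ℂ) (dzbar f w) / dz f w := by
    filter_upwards [hev] with w hw
    exact dilatation_eq_of_continuousAt
      ((hka w hw.1).continuousAt.div (hha w hw.1).continuousAt hw.2)
  have hω' : dilatation f =ᶠ[𝓝 z] fun w => (starRingEnd ℂ) (dzbar f w) / dz f w := hω
  refine ⟨((hka z hz.1).div (hha z hz.1) hz0).congr hω'.symm, ?_, ?_, ?_⟩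
  · rw [hω'.deriv_eq, ((hka z hz.1).differentiableAt.hasDerivAt.fun_div
      (hha z hz.1).differentiableAt.hasDerivAt hz0).deriv]
    exact div_ne_zero hzW (pow_ne_zero 2 hz0)
  · rw [hω.self_of_nhds]
    have h1 := hz.2
    rw [jacobian_eq, sub_eq_zero] at h1
    have h2 := (pow_left_inj₀ (norm_nonneg _) (norm_nonneg _) two_ne_zero).1 h1
    rw [norm_div, ← h2, div_self (norm_ne_zero_iff.2 hz0)]
  · filter_upwards [hev, hω] with w hw hωw
    have hpos : 0 < ‖dz f w‖ := norm_pos_iff.2 hw.2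
    refine ⟨hw.1, ?_, ?_⟩
    · rw [hωw, norm_div, div_lt_one hpos, jacobian_eq, sub_pos]
      exact pow_lt_pow_iff_left₀ (norm_nonneg _) (norm_nonneg _) two_ne_zero
    · rw [hωw, norm_div, one_lt_div hpos, jacobian_eq, sub_neg]
      exact pow_lt_pow_iff_left₀ (norm_nonneg _) (norm_nonneg _) two_ne_zero

end HarmonicCount

/-! ### Jump of the winding number across a critical arc -/

namespace HarmonicCount

open Set Complex

theorem abs_winding_sub_le {u v : ℝ → ℂ} {a b : ℝ} (hab : a ≤ b) (hu : ContinuousOn u (Icc a b))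
    (hv : ContinuousOn v (Icc a b)) (hv0 : ∀ t ∈ Icc a b, v t ≠ 0)
    (h : ∀ t ∈ Icc a b, ‖u t - v t‖ ≤ 1 / 4 * ‖v t‖) :
    |winding u a b - winding v a b| ≤ 1 / 8 := by
  have hu0 : ∀ t ∈ Icc a b, u t ≠ 0 := by
    intro t ht h0
    have h1 := h t ht
    have h2 := norm_pos_iff.2 (hv0 t ht)
    rw [h0, zero_sub, norm_neg] at h1
    linarith
  rw [← winding_div hab hu hu0 hv hv0]
  refine abs_winding_le_of_near_one hab (hu.div hv hv0) fun t ht => ?_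
  rw [div_sub_one (hv0 t ht), norm_div, div_le_iff₀ (norm_pos_iff.2 (hv0 t ht))]
  exact h t ht

/-- On an arc that is far from `z₀`, the arguments with respect to two points near `z₀` change by
almost the same amount. -/
theorem abs_winding_sub_sub_le {c : ℝ → ℂ} {a b ε : ℝ} {z₀ p q : ℂ} (hab : a ≤ b)
    (hc : ContinuousOn c (Icc a b)) (hε : ∀ t ∈ Icc a b, ε ≤ ‖c t - z₀‖) (hp : ‖p - z₀‖ < ε / 10)
    (hq : ‖q - z₀‖ < ε / 10) :
    |winding (fun t => c t - p) a b - winding (fun t => c t - q) a b| ≤ 1 / 8 := by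
  have hlow : ∀ t ∈ Icc a b, 9 / 10 * ε < ‖c t - q‖ := by
    intro t ht
    have h1 := norm_sub_norm_le (c t - z₀) (q - z₀)
    rw [sub_sub_sub_cancel_right] at h1
    have := hε t ht
    linarith
  have hε0 : 0 < ε := by linarith [norm_nonneg (p - z₀)]
  refine abs_winding_sub_le hab (hc.sub continuousOn_const) (hc.sub continuousOn_const)
    (fun t ht => ?_) (fun t ht => ?_)
  · exact norm_pos_iff.1 (lt_trans (by linarith) (hlow t ht))
  · have h1 := norm_sub_le (q - z₀) (p - z₀)
    rw [sub_sub_sub_cancel_right] at h1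
    rw [sub_sub_sub_cancel_left]
    have := hlow t ht
    linarith

theorem circleMap_zero_one (t : ℝ) : circleMap 0 1 t = exp (t * I) := by simp [circleMap]

theorem exists_pos_le_norm_sub {c : ℝ → ℂ} {T : Set ℝ} (hT : IsCompact T) (hc : ContinuousOn c T)
    {z₀ : ℂ} (h : ∀ t ∈ T, c t ≠ z₀) : ∃ ε > 0, ∀ t ∈ T, ε ≤ ‖c t - z₀‖ := by
  have hcl : IsClosed (c '' T) := (hT.image_of_continuousOn hc).isClosed
  have hz : z₀ ∈ (c '' T)ᶜ := by
    rintro ⟨t, ht, h1⟩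
    exact h t ht h1
  obtain ⟨ε, hε, hball⟩ := Metric.isOpen_iff.1 hcl.isOpen_compl z₀ hz
  refine ⟨ε, hε, fun t ht => ?_⟩
  by_contra! h1
  exact hball (mem_ball_iff_norm.2 h1) ⟨t, ht, rfl⟩

/-- **Jump of the winding number**: a closed curve with `ω (c t) = exp (i t)` that passes once
through `z₀` winds once more about points close to `z₀` with `|ω| < 1` than about those with
`|ω| > 1`. -/
theorem exists_ball_windingNumber_jump {ω : ℂ → ℂ} {z₀ d : ℂ} (hω : HasStrictDerivAt ω d z₀)
    (hd : d ≠ 0) {c : ℝ → ℂ} {a b t₀ : ℝ} (hc : ContinuousOn c (Icc a b)) (hcl : c a = c b)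
    (hcω : ∀ t ∈ Icc a b, ω (c t) = exp (t * I)) (ht₀ : t₀ ∈ Ioo a b) (hct₀ : c t₀ = z₀)
    (honce : ∀ t ∈ Icc a b, c t = z₀ → t = t₀) :
    ∃ r > 0, ∀ p ∈ Metric.ball z₀ r, ∀ q ∈ Metric.ball z₀ r, ‖ω p‖ < 1 → 1 < ‖ω q‖ →
      windingNumber c a b p - windingNumber c a b q = 1 := by
  have hpi := Real.pi_gt_three
  have ht₀' : t₀ ∈ Icc a b := Ioo_subset_Icc_self ht₀
  have hωz₀ : ω z₀ = exp (t₀ * I) := by rw [← hct₀, hcω t₀ ht₀']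
  have hd0 : 0 < ‖d‖ := norm_pos_iff.2 hd
  -- Strict differentiability is essential: ω z - ω p must be compared with d(z - p) uniformly in
  -- both points, since p approaches z₀ while z runs along the curve.
  obtain ⟨r₁, hr₁, hstrict⟩ : ∃ r₁ > 0, ∀ z ∈ Metric.ball z₀ r₁, ∀ p ∈ Metric.ball z₀ r₁,
      ‖ω z - ω p - d * (z - p)‖ ≤ 1 / 4 * ‖d * (z - p)‖ := by
    have h1 := (hasStrictFDerivAt_iff_isLittleO.1 hω.hasStrictFDerivAt).def
      (show 0 < 1 / 4 * ‖d‖ by positivity)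
    obtain ⟨r₁, hr₁, h2⟩ := Metric.eventually_nhds_iff_ball.1 h1
    refine ⟨r₁, hr₁, fun z hz p hp => ?_⟩
    have h3 := h2 (z, p) (by rw [← ball_prod_same]; exact ⟨hz, hp⟩)
    simp only [ContinuousLinearMap.toSpanSingleton_apply, smul_eq_mul] at h3
    rw [norm_mul, ← mul_assoc, mul_comm d]
    exact h3
  -- The curve is cut into a short middle piece near z₀ and two outer pieces away from z₀. The bound
  -- δ ≤ 1 keeps 2δ below 2π, so that the unit circle has a complementary arc.
  obtain ⟨δ, hδ, hδ1, hδa, hδb, hδc⟩ : ∃ δ > 0, δ ≤ 1 ∧ a ≤ t₀ - δ ∧ t₀ + δ ≤ b ∧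
      ∀ t ∈ Icc (t₀ - δ) (t₀ + δ), c t ∈ Metric.ball z₀ r₁ := by
    have hct : ContinuousAt c t₀ := hc.continuousAt (Icc_mem_nhds ht₀.1 ht₀.2)
    have hmem : c ⁻¹' Metric.ball z₀ r₁ ∈ 𝓝 t₀ :=
      hct.preimage_mem_nhds (by rw [hct₀]; exact Metric.ball_mem_nhds _ hr₁)
    obtain ⟨δ₀, hδ₀, hsub⟩ := Metric.nhds_basis_closedBall.mem_iff.1 hmem
    refine ⟨min δ₀ (min 1 (min (t₀ - a) (b - t₀))), ?_, ?_, ?_, ?_, ?_⟩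
    · have := ht₀.1
      have := ht₀.2
      refine lt_min hδ₀ (lt_min one_pos (lt_min ?_ ?_)) <;> linarith
    · exact (min_le_right _ _).trans (min_le_left _ _)
    · have : min δ₀ (min 1 (min (t₀ - a) (b - t₀))) ≤ t₀ - a :=
        (min_le_right _ _).trans ((min_le_right _ _).trans (min_le_left _ _))
      linarith
    · have : min δ₀ (min 1 (min (t₀ - a) (b - t₀))) ≤ b - t₀ :=
        (min_le_right _ _).trans ((min_le_right _ _).trans (min_le_right _ _))
      linarith
    · intro t ht
      apply hsub
      have : min δ₀ (min 1 (min (t₀ - a) (b - t₀))) ≤ δ₀ := min_le_left _ _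
      rw [Metric.mem_closedBall, Real.dist_eq, abs_le]
      constructor <;> linarith [ht.1, ht.2]
  have hI₁ : Icc a (t₀ - δ) ⊆ Icc a b := Icc_subset_Icc_right (by linarith)
  have hI₂ : Icc (t₀ - δ) (t₀ + δ) ⊆ Icc a b := Icc_subset_Icc hδa hδb
  have hI₃ : Icc (t₀ + δ) b ⊆ Icc a b := Icc_subset_Icc_left (by linarith)
  obtain ⟨ε₁, hε₁, hfar₁⟩ := exists_pos_le_norm_sub isCompact_Icc (hc.mono hI₁) (z₀ := z₀)
    (fun t ht h => by
      have := honce t (hI₁ ht) h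
      linarith [ht.2])
  obtain ⟨ε₃, hε₃, hfar₃⟩ := exists_pos_le_norm_sub isCompact_Icc (hc.mono hI₃) (z₀ := z₀)
    (fun t ht h => by
      have := honce t (hI₃ ht) h
      linarith [ht.1])
  have hcirc : Continuous fun t : ℝ => circleMap 0 1 t := continuous_circleMap 0 1
  -- The complementary arc of the unit circle avoids ω z₀ = exp(i t₀): a coincidence would be a
  -- shift of the parameter by 2πm with 0 < m < 1.
  obtain ⟨ε₂, hε₂, hfar₂⟩ := exists_pos_le_norm_sub
    (isCompact_Icc (a := t₀ + δ) (b := t₀ - δ + 2 * Real.pi)) hcirc.continuousOn (z₀ := ω z₀)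
    (fun t ht h => by
      rw [hωz₀, circleMap_zero_one] at h
      obtain ⟨m, hm⟩ := exp_eq_exp_iff_exists_int.1 h
      have h1 := congrArg Complex.im hm
      simp at h1
      have h2 : (0 : ℝ) < m := by
        have : 0 < (m : ℝ) * (2 * Real.pi) := by linarith [ht.1]
        exact pos_of_mul_pos_left this (by positivity)
      have h3 : (m : ℝ) < 1 := by
        have : (m : ℝ) * (2 * Real.pi) < 1 * (2 * Real.pi) := by linarith [ht.2]
        exact lt_of_mul_lt_mul_right this (by positivity)
      have h4 : (0 : ℤ) < m := by exact_mod_cast h2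
      have h5 : m < (1 : ℤ) := by exact_mod_cast h3
      omega)
  obtain ⟨r₂, hr₂, hωnear⟩ : ∃ r₂ > 0, ∀ p ∈ Metric.ball z₀ r₂, ‖ω p - ω z₀‖ < ε₂ / 10 := by
    have h1 := Metric.continuousAt_iff.1 hω.hasDerivAt.continuousAt (ε₂ / 10) (by positivity)
    obtain ⟨r₂, hr₂, h2⟩ := h1
    exact ⟨r₂, hr₂, fun p hp => by rw [← dist_eq_norm]; exact h2 hp⟩
  refine ⟨min (min r₁ r₂) (min (ε₁ / 10) (ε₃ / 10)), by positivity, fun p hp q hq hωp hωq => ?_⟩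
  have hlt : ∀ x ∈ Metric.ball z₀ (min (min r₁ r₂) (min (ε₁ / 10) (ε₃ / 10))),
      x ∈ Metric.ball z₀ r₁ ∧ x ∈ Metric.ball z₀ r₂ ∧ ‖x - z₀‖ < ε₁ / 10 ∧ ‖x - z₀‖ < ε₃ / 10 := by
    intro x hx
    rw [Metric.mem_ball] at hx
    simp only [lt_min_iff, ← dist_eq_norm, Metric.mem_ball] at hx ⊢
    tauto
  obtain ⟨hp1, hp2, hp3, hp4⟩ := hlt p hp
  obtain ⟨hq1, hq2, hq3, hq4⟩ := hlt q hq
  have hnorm : ∀ t ∈ Icc a b, ‖ω (c t)‖ = 1 := fun t ht => by rw [hcω t ht, norm_exp_ofReal_mul_I]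
  have hoff : ∀ x, ‖ω x‖ ≠ 1 → ∀ t ∈ Icc a b, c t - x ≠ 0 := by
    intro x hx t ht h
    rw [sub_eq_zero] at h
    exact hx (by rw [← h, hnorm t ht])
  have hsplit : ∀ x, ‖ω x‖ ≠ 1 → windingNumber c a b x = winding (fun t => c t - x) a (t₀ - δ) +
      winding (fun t => c t - x) (t₀ - δ) (t₀ + δ) + winding (fun t => c t - x) (t₀ + δ) b := by
    intro x hx
    have h1 : ContinuousOn (fun t => c t - x) (Icc a b) := hc.sub continuousOn_const
    rw [windingNumber, winding_add_adjacent (b := t₀ + δ) (by linarith) hδb h1 (hoff x hx),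
      winding_add_adjacent (b := t₀ - δ) hδa (by linarith)
        (h1.mono (Icc_subset_Icc_right hδb))
        (fun t ht => hoff x hx t (Icc_subset_Icc_right hδb ht))]
  -- On the middle piece exp(it) - ω x = ω(c t) - ω x is close to d(c t - x), and the constant
  -- factor d does not change the winding. Thus the curve winds about x almost as the circular arc
  -- does about ω x.
  have hmid : ∀ x ∈ Metric.ball z₀ r₁, ‖ω x‖ ≠ 1 →
      |winding (fun t => circleMap 0 1 t - ω x) (t₀ - δ) (t₀ + δ) -
        winding (fun t => c t - x) (t₀ - δ) (t₀ + δ)| ≤ 1 / 8 := by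
    intro x hx hx1
    have hcx : ContinuousOn (fun t => c t - x) (Icc (t₀ - δ) (t₀ + δ)) :=
      (hc.mono hI₂).sub continuousOn_const
    have hne : ∀ t ∈ Icc (t₀ - δ) (t₀ + δ), c t - x ≠ 0 := fun t ht => hoff x hx1 t (hI₂ ht)
    have h1 : winding (fun t => d * (c t - x)) (t₀ - δ) (t₀ + δ) =
        winding (fun t => c t - x) (t₀ - δ) (t₀ + δ) := by
      rw [winding_mul (by linarith) continuousOn_const (fun _ _ => hd) hcx hne,
        winding_const hd (by linarith), zero_add]
    rw [← h1]
    refine abs_winding_sub_le (by linarith) (hcirc.sub continuous_const).continuousOn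
      (continuousOn_const.mul hcx) (fun t ht => mul_ne_zero hd (hne t ht)) (fun t ht => ?_)
    rw [circleMap_zero_one, ← hcω t (hI₂ ht)]
    exact hstrict _ (hδc t ht) _ hx
  have hfull : ∀ x, ‖ω x‖ ≠ 1 → windingNumber (circleMap 0 1) (t₀ - δ) (t₀ - δ + 2 * Real.pi) (ω x) =
      winding (fun t => circleMap 0 1 t - ω x) (t₀ - δ) (t₀ + δ) +
      winding (fun t => circleMap 0 1 t - ω x) (t₀ + δ) (t₀ - δ + 2 * Real.pi) := by
    intro x hx
    refine winding_add_adjacent (by linarith) (by linarith)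
      (hcirc.sub continuous_const).continuousOn (fun t _ h => hx ?_)
    rw [← sub_eq_zero.1 h, circleMap_zero_one, norm_exp_ofReal_mul_I]
  have e1 := hsplit p hωp.ne
  have e2 := hsplit q hωq.ne'
  have e3 := hfull p hωp.ne
  have e4 := hfull q hωq.ne'
  rw [windingNumber_circleMap_of_lt (by simpa using hωp)] at e3
  rw [windingNumber_circleMap_of_gt zero_le_one (by simpa using hωq)] at e4
  have b1 := abs_le.1 (hmid p hp1 hωp.ne)
  have b2 := abs_le.1 (hmid q hq1 hωq.ne')
  have b3 := abs_le.1 (abs_winding_sub_sub_le hδa (hc.mono hI₁) hfar₁ hp3 hq3)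
  have b4 := abs_le.1 (abs_winding_sub_sub_le hδb (hc.mono hI₃) hfar₃ hp4 hq4)
  have b5 := abs_le.1 (abs_winding_sub_sub_le (by linarith) hcirc.continuousOn hfar₂
    (hωnear p hp2) (hωnear q hq2))
  have hab : a ≤ b := (ht₀.1.trans ht₀.2).le
  obtain ⟨m, hm⟩ := exists_int_winding_eq hab (hc.sub continuousOn_const) (hoff p hωp.ne)
    (by simp [hcl])
  obtain ⟨l, hl⟩ := exists_int_winding_eq hab (hc.sub continuousOn_const) (hoff q hωq.ne')
    (by simp [hcl])
  have hm' : windingNumber c a b p = m := hm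
  have hl' : windingNumber c a b q = l := hl
  -- The full circle winds 1 about ω p and 0 about ω q. Five comparisons (two outer pieces, two
  -- middle pieces, the complementary arc) cost at most 1/8 each, so the integer m - l is within 5/8
  -- of 1.
  have hlow : (0 : ℝ) < ((m - l : ℤ) : ℝ) := by
    push_cast
    linarith [b1.1, b1.2, b2.1, b2.2, b3.1, b3.2, b4.1, b4.2, b5.1, b5.2]
  have hup : ((m - l : ℤ) : ℝ) < 2 := by
    push_cast
    linarith [b1.1, b1.2, b2.1, b2.2, b3.1, b3.2, b4.1, b4.2, b5.1, b5.2]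
  have h1 : (0 : ℤ) < m - l := by exact_mod_cast hlow
  have h2 : m - l < (2 : ℤ) := by exact_mod_cast hup
  have h3 : m - l = 1 := by omega
  rw [hm', hl']
  exact_mod_cast h3

end HarmonicCount

/-! ### Local sides of a level curve and a constancy principle -/

namespace HarmonicCount

open Set Complex

/-- The two sides of the level curve `Re ψ = 0` near a regular point. -/
theorem exists_nhd_two_sides {ψ : ℂ → ℂ} {z d : ℂ} (hψ : HasStrictDerivAt ψ d z) (hd : d ≠ 0)
    (h0 : ψ z = 0) {N : Set ℂ} (hN : N ∈ 𝓝 z) :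
    ∃ V ⊆ N, IsOpen V ∧ z ∈ V ∧ ∀ s : ℝ, s = 1 ∨ s = -1 →
      IsPreconnected (V ∩ {w | 0 < s * (ψ w).re}) ∧ (V ∩ {w | 0 < s * (ψ w).re}).Nonempty ∧
      ∀ w ∈ V, (ψ w).re = 0 → w ∈ closure (V ∩ {w | 0 < s * (ψ w).re}) := by
  -- By the inverse function theorem ψ is a local homeomorphism, so the two sides are images of
  -- convex half-discs.
  have hF := hψ.hasStrictFDerivAt_equiv hd
  set e := hF.toOpenPartialHomeomorph ψ with he
  have hcoe : ∀ w, e w = ψ w := fun w => by rw [he, hF.toOpenPartialHomeomorph_coe]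
  have hz : z ∈ e.source := hF.mem_toOpenPartialHomeomorph_source
  have hez : e z = 0 := by rw [hcoe, h0]
  have h0t : (0 : ℂ) ∈ e.target := hez ▸ e.map_source hz
  have hsymm0 : e.symm 0 = z := by rw [← hez, e.left_inv hz]
  have hmem : e.target ∩ e.symm ⁻¹' N ∈ 𝓝 (0 : ℂ) := by
    refine inter_mem (e.open_target.mem_nhds h0t) ?_
    exact (e.continuousAt_symm h0t).preimage_mem_nhds (by rwa [hsymm0])
  obtain ⟨ρ, hρ, hball⟩ := Metric.mem_nhds_iff.1 hmem
  refine ⟨e.source ∩ e ⁻¹' Metric.ball 0 ρ, ?_, e.isOpen_inter_preimage Metric.isOpen_ball,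
    ⟨hz, by simp [hez, hρ]⟩, fun s hs => ?_⟩
  · rintro w ⟨hw, hwb⟩
    have := (hball hwb).2
    rwa [mem_preimage, e.left_inv hw] at this
  have hside : e.source ∩ e ⁻¹' Metric.ball 0 ρ ∩ {w | 0 < s * (ψ w).re} =
      e.symm '' (Metric.ball 0 ρ ∩ {w | 0 < s * w.re}) := by
    ext w
    constructor
    · rintro ⟨⟨hw, hwb⟩, hws⟩
      exact ⟨e w, ⟨hwb, by rw [mem_ofPred_eq, hcoe]; exact hws⟩, e.left_inv hw⟩
    · rintro ⟨v, ⟨hv, hvs⟩, rfl⟩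
      have hvt := (hball hv).1
      refine ⟨⟨e.map_target hvt, ?_⟩, ?_⟩
      · rwa [mem_preimage, e.right_inv hvt]
      · rw [mem_ofPred_eq, ← hcoe, e.right_inv hvt]
        exact hvs
  have hcont : ContinuousOn e.symm (Metric.ball 0 ρ) :=
    e.continuousOn_symm.mono fun v hv => (hball hv).1
  have hconv : Convex ℝ (Metric.ball (0 : ℂ) ρ ∩ {w | 0 < s * w.re}) := by
    refine (convex_ball _ _).inter ?_
    have h1 : IsLinearMap ℝ fun w : ℂ => s * w.re :=
      ⟨fun x y => by simp [mul_add], fun c x => by simp; ring⟩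
    exact convex_halfSpace_gt h1 0
  have hss : s * s = 1 := by rcases hs with rfl | rfl <;> norm_num
  have hsn : |s| = 1 := by rcases hs with rfl | rfl <;> norm_num
  have hclos : ∀ v ∈ Metric.ball (0 : ℂ) ρ, v.re = 0 →
      v ∈ closure (Metric.ball (0 : ℂ) ρ ∩ {w | 0 < s * w.re}) := by
    intro v hv hvre
    rw [Metric.mem_closure_iff]
    intro ε hε
    rw [mem_ball_zero_iff] at hv
    set x := min ε (ρ - ‖v‖) / 2 with hx
    have hx0 : 0 < x := by
      have : 0 < min ε (ρ - ‖v‖) := lt_min hε (by linarith)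
      positivity
    have hxε : x < ε := by
      have : min ε (ρ - ‖v‖) ≤ ε := min_le_left _ _
      linarith
    have hxρ : x < ρ - ‖v‖ := by
      have : min ε (ρ - ‖v‖) ≤ ρ - ‖v‖ := min_le_right _ _
      linarith
    have hnx : ‖((s * x : ℝ) : ℂ)‖ = x := by
      rw [norm_real, Real.norm_eq_abs, abs_mul, hsn, one_mul, abs_of_pos hx0]
    refine ⟨v + (s * x : ℝ), ⟨?_, ?_⟩, ?_⟩
    · rw [mem_ball_zero_iff]
      have := norm_add_le v ((s * x : ℝ) : ℂ)
      rw [hnx] at this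
      linarith
    · rw [mem_ofPred_eq, add_re, ofReal_re, hvre, zero_add, ← mul_assoc, hss, one_mul]
      exact hx0
    · rw [dist_self_add_right, hnx]
      exact hxε
  rw [hside]
  refine ⟨hconv.isPreconnected.image _ (hcont.mono inter_subset_left), ?_, ?_⟩
  · have h1 := hclos 0 (Metric.mem_ball_self hρ) rfl
    exact (closure_nonempty_iff.1 ⟨0, h1⟩).image _
  · rintro w ⟨hw, hwb⟩ hwre
    have h1 := hclos (e w) hwb (by rw [hcoe]; exact hwre)
    have h2 : ContinuousWithinAt e.symm (Metric.ball (0 : ℂ) ρ ∩ {w | 0 < s * w.re}) (e w) :=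
      (e.continuousAt_symm (hball hwb).1).continuousWithinAt
    have h3 := h2.mem_closure_image h1
    rwa [e.left_inv hw] at h3

/-- The two sides of the level curve `|ω| = 1` near a regular point. -/
theorem exists_nhd_two_sides_norm {ω : ℂ → ℂ} {z d : ℂ} (hω : HasStrictDerivAt ω d z) (hd : d ≠ 0)
    (h1 : ‖ω z‖ = 1) {N : Set ℂ} (hN : N ∈ 𝓝 z) :
    ∃ V ⊆ N, IsOpen V ∧ z ∈ V ∧
      (IsPreconnected (V ∩ {w | ‖ω w‖ < 1}) ∧ (V ∩ {w | ‖ω w‖ < 1}).Nonempty ∧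
        ∀ w ∈ V, ‖ω w‖ = 1 → w ∈ closure (V ∩ {w | ‖ω w‖ < 1})) ∧
      (IsPreconnected (V ∩ {w | 1 < ‖ω w‖}) ∧ (V ∩ {w | 1 < ‖ω w‖}).Nonempty ∧
        ∀ w ∈ V, ‖ω w‖ = 1 → w ∈ closure (V ∩ {w | 1 < ‖ω w‖})) := by
  have hz0 : ω z ≠ 0 := norm_ne_zero_iff.1 (by rw [h1]; exact one_ne_zero)
  -- Taking a logarithm of ω/ω(z) turns the level curve |ω| = 1 into Re ψ = 0.
  have hψ : HasStrictDerivAt (fun w => log (ω w / ω z)) (d / ω z / (ω z / ω z)) z :=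
    (hω.div_const (ω z)).clog (by rw [div_self hz0]; exact one_mem_slitPlane)
  rw [div_self hz0, div_one] at hψ
  have hne : {w | ω w ≠ 0} ∈ 𝓝 z := hω.hasDerivAt.continuousAt.eventually_ne hz0
  obtain ⟨V, hVN, hVo, hzV, hV⟩ := exists_nhd_two_sides hψ (div_ne_zero hd hz0)
    (by simp [div_self hz0]) (inter_mem hN hne)
  have hre : ∀ w, (log (ω w / ω z)).re = Real.log ‖ω w‖ := fun w => by
    rw [log_re, norm_div, h1, div_one]
  have hpos : ∀ w ∈ V, 0 < ‖ω w‖ := fun w hw => norm_pos_iff.2 (hVN hw).2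
  have hlt : V ∩ {w | 0 < (-1 : ℝ) * (log (ω w / ω z)).re} = V ∩ {w | ‖ω w‖ < 1} := by
    ext w
    refine and_congr_right fun hw => ?_
    rw [mem_ofPred_eq, mem_ofPred_eq, hre, neg_one_mul, neg_pos,
      Real.log_neg_iff (hpos w hw)]
  have hgt : V ∩ {w | 0 < (1 : ℝ) * (log (ω w / ω z)).re} = V ∩ {w | 1 < ‖ω w‖} := by
    ext w
    refine and_congr_right fun hw => ?_
    rw [mem_ofPred_eq, mem_ofPred_eq, hre, one_mul, Real.log_pos_iff (hpos w hw).le]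
  have h2 := hV (-1) (Or.inr rfl)
  have h3 := hV 1 (Or.inl rfl)
  rw [hlt] at h2
  rw [hgt] at h3
  refine ⟨V, fun w hw => (hVN hw).1, hVo, hzV, ⟨h2.1, h2.2.1, fun w hw hw1 => ?_⟩,
    ⟨h3.1, h3.2.1, fun w hw hw1 => ?_⟩⟩
  · exact h2.2.2 w hw (by rw [hre, hw1, Real.log_one])
  · exact h3.2.2 w hw (by rw [hre, hw1, Real.log_one])

/-- A function that is locally constant off a closed nowhere dense set, and has only one value near
each point of that set with finitely many exceptions, is constant. -/
theorem exists_const_of_local_const {Φ : ℂ → ℝ} {B : Set ℂ} (hB : Dense Bᶜ) {E : Set ℂ}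
    (hE : E.Finite)
    (hΦ : ∀ z ∉ E, ∃ c, ∀ᶠ w in 𝓝 z, w ∉ B → Φ w = c) (hEB : E ⊆ B) :
    ∃ c, ∀ z ∉ B, Φ z = c := by
  have hconn : IsConnected Eᶜ :=
    Set.Countable.isConnected_compl_of_one_lt_rank (E := ℂ) (by simp) hE.countable
  obtain ⟨z₁, hz₁⟩ := hconn.nonempty
  obtain ⟨c, hc⟩ := hΦ z₁ hz₁
  refine ⟨c, ?_⟩
  -- The points with local value c and those with a local value other than c form two open sets
  -- covering the complement of E. They are disjoint because the complement of B is dense.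
  have hsub : Eᶜ ⊆ {z | ∀ᶠ w in 𝓝 z, w ∉ B → Φ w = c} := by
    refine IsPreconnected.subset_left_of_subset_union
      (v := {z | ∀ᶠ w in 𝓝 z, w ∉ B → Φ w ≠ c}) ?_ ?_ ?_ ?_ ⟨z₁, hz₁, hc⟩ hconn.isPreconnected
    · exact isOpen_iff_eventually.2 fun z hz => eventually_eventually_nhds.2 hz
    · exact isOpen_iff_eventually.2 fun z hz => eventually_eventually_nhds.2 hz
    · rw [disjoint_left]
      intro z h1 h2
      rw [mem_ofPred_eq] at h1 h2
      obtain ⟨w, hw, hwB⟩ := mem_closure_iff_nhds.1 (hB z) _ (h1.and h2)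
      exact hw.2 hwB (hw.1 hwB)
    · intro z hz
      obtain ⟨c', hc'⟩ := hΦ z hz
      by_cases h : c' = c
      · exact Or.inl (h ▸ hc')
      · right
        rw [mem_ofPred_eq]
        filter_upwards [hc'] with w hw hwB
        rw [hw hwB]
        exact h
  intro z hz
  have h1 : z ∈ Eᶜ := fun h => hz (hEB h)
  have h2 := hsub h1
  rw [mem_ofPred_eq] at h2
  exact h2.self_of_nhds hz

end HarmonicCount

/-! ### The total winding number of the critical curves -/

namespace HarmonicCount

open Set Complex

variable {f : ℂ → ℂ} {S : Finset ℂ} {A B : Set ℂ} {n : ℕ} {a b : Fin n → ℝ} {γ : Fin n → ℝ → ℂ}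

theorem IsCritParam.mem (hγ : IsCritParam f B a b γ) {j : Fin n} {t : ℝ}
    (ht : t ∈ Icc (a j) (b j)) : γ j t ∈ B := by
  rw [← hγ.trace_eq]
  exact mem_iUnion.2 ⟨j, t, ht, rfl⟩

/-- The total winding number of the curves is locally constant off their traces. -/
theorem IsCritParam.eventually_sum_windingNumber_eq (hγ : IsCritParam f B a b γ) {p : ℂ}
    (hp : p ∉ B) :
    ∀ᶠ q in 𝓝 p, ∑ j, windingNumber (γ j) (a j) (b j) q =
      ∑ j, windingNumber (γ j) (a j) (b j) p := by
  have h : ∀ j, ∀ᶠ q in 𝓝 p, windingNumber (γ j) (a j) (b j) q =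
      windingNumber (γ j) (a j) (b j) p := fun j =>
    eventually_windingNumber_eq (hγ.lt j).le (hγ.continuousOn j) (hγ.closed j) (by
      rintro ⟨t, ht, rfl⟩
      exact hp (hγ.mem ht))
  filter_upwards [eventually_all.2 h] with q hq
  exact Finset.sum_congr rfl fun j _ => hq j

theorem IsCritParam.eventually_sum_windingNumber_eq_zero (hγ : IsCritParam f B a b γ) :
    ∀ᶠ q in Bornology.cobounded ℂ, ∑ j, windingNumber (γ j) (a j) (b j) q = 0 := by
  have h : ∀ j, ∀ᶠ q in Bornology.cobounded ℂ, windingNumber (γ j) (a j) (b j) q = 0 := fun j =>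
    eventually_windingNumber_eq_zero (hγ.lt j).le (hγ.continuousOn j) (hγ.closed j)
  filter_upwards [eventually_all.2 h] with q hq
  exact Finset.sum_eq_zero fun j _ => hq j

/-- The jump of the total winding number across a critical arc. -/
theorem IsCritParam.exists_nhd_jump (hγ : IsCritParam f B a b γ) {z d : ℂ} (hz : z ∈ B)
    (hω : HasStrictDerivAt (dilatation f) d z) (hd : d ≠ 0) (hza : ∀ j, γ j (a j) ≠ z) :
    ∃ N ∈ 𝓝 z, ∀ p ∈ N, ∀ q ∈ N, ‖dilatation f p‖ < 1 → 1 < ‖dilatation f q‖ →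
      ∑ j, windingNumber (γ j) (a j) (b j) p - ∑ j, windingNumber (γ j) (a j) (b j) q = 1 := by
  obtain ⟨⟨j₀, t₀⟩, ⟨ht₀, hzt₀⟩, huniq⟩ := hγ.once z hz (by rwa [hω.hasDerivAt.deriv])
  have honce : ∀ j, ∀ t ∈ Icc (a j) (b j), γ j t = z → j = j₀ ∧ t = t₀ := by
    intro j t ht htz
    have htb : t ≠ b j := by
      rintro rfl
      exact hza j (by rw [hγ.closed j, htz])
    have := huniq (j, t) ⟨⟨ht.1, lt_of_le_of_ne ht.2 htb⟩, htz⟩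
    exact ⟨congrArg Prod.fst this, congrArg Prod.snd this⟩
  -- The jump lemma needs an interior parameter. Base points are excluded, and with them the
  -- endpoint b j, since the curves are closed.
  have hat₀ : a j₀ ≠ t₀ := by
    intro h
    exact hza j₀ (by rw [h]; exact hzt₀)
  obtain ⟨r, hr, hjump⟩ := exists_ball_windingNumber_jump hω hd (hγ.continuousOn j₀)
    (hγ.closed j₀) (hγ.dilatation_eq j₀) ⟨lt_of_le_of_ne ht₀.1 hat₀, ht₀.2⟩ hzt₀
    (fun t ht htz => (honce j₀ t ht htz).2)
  have hother : ∀ j, ∀ᶠ q in 𝓝 z, j ≠ j₀ → windingNumber (γ j) (a j) (b j) q =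
      windingNumber (γ j) (a j) (b j) z := by
    intro j
    by_cases hj : j = j₀
    · exact Eventually.of_forall fun q h => absurd hj h
    · filter_upwards [eventually_windingNumber_eq (hγ.lt j).le (hγ.continuousOn j) (hγ.closed j) (by
        rintro ⟨t, ht, htz⟩
        exact hj (honce j t ht htz).1)] with q hq _ using hq
  refine ⟨_, inter_mem (Metric.ball_mem_nhds z hr) (eventually_all.2 hother), ?_⟩
  rintro p ⟨hp, hp'⟩ q ⟨hq, hq'⟩ hωp hωq
  rw [mem_ofPred_eq] at hp' hq'
  rw [← Finset.sum_sub_distrib, Finset.sum_eq_single j₀ (fun j _ hj => by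
    rw [hp' j hj, hq' j hj, sub_self]) (fun h => absurd (Finset.mem_univ _) h)]
  exact hjump p hp q hq hωp hωq

/-- The curves wind about the points of the tile `σ` times more than about the points outside its
closure, where `σ` is the sign of the Jacobian on the tile. -/
theorem IsCritParam.exists_sum_windingNumber_eq (hf : NonDegenerate f S) (hA : IsTile f S A)
    (hγ : IsCritParam f (frontier A \ exceptSet f S) a b γ) {σ : ℝ}
    (hσ : (σ = 1 ∧ ∀ z ∈ A, ∀ᶠ w in 𝓝[≠] z, 0 < jacobian f w) ∨
      (σ = -1 ∧ ∀ z ∈ A, ∀ᶠ w in 𝓝[≠] z, jacobian f w < 0)) :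
    ∃ c, ∀ p ∉ frontier A, ∑ j, windingNumber (γ j) (a j) (b j) p =
      A.indicator (fun _ => σ) p + c := by
  set F : ℂ → ℝ := fun p => ∑ j, windingNumber (γ j) (a j) (b j) p with hF
  have hAo := hA.isOpen hf
  -- Only at these finitely many boundary points can the jump lemma fail. The points of ℳ on ∂A are
  -- among them, because a non-singular critical point has |ω| = 1.
  let E : Set ℂ := (singularSet f S ∪ range fun j => γ j (a j)) ∩ frontier A
  have hE : E.Finite := (hf.finite_singularSet.union (finite_range _)).inter_of_left _
  have hdense : Dense (frontier A)ᶜ := by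
    have h1 : interior (frontier A) = ∅ := by
      rw [← frontier_compl]
      exact interior_frontier hAo.isClosed_compl
    rwa [interior_eq_empty_iff_dense_compl] at h1
  have key : ∀ z ∉ E, ∃ c, ∀ᶠ w in 𝓝 z, w ∉ frontier A →
      F w - A.indicator (fun _ => σ) w = c := by
    intro z hz
    by_cases hzf : z ∈ frontier A
    · have hzC := hA.frontier_subset hf hzf
      have hzs : z ∉ singularSet f S := fun h => hz ⟨Or.inl h, hzf⟩
      have hza : ∀ j, γ j (a j) ≠ z := fun j h => hz ⟨Or.inr ⟨j, h⟩, hzf⟩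
      obtain ⟨hωa, hωd, hω1, hreg⟩ := hf.dilatation_regular hzC hzs
      have hzM : z ∉ exceptSet f S := fun h => h.2 hω1
      obtain ⟨N, hN, hjump⟩ := hγ.exists_nhd_jump ⟨hzf, hzM⟩ hωa.hasStrictDerivAt hωd hza
      obtain ⟨V, hVN, hVo, hzV, ⟨hlc, hln, hlcl⟩, ⟨hgc, hgn, hgcl⟩⟩ :=
        exists_nhd_two_sides_norm hωa.hasStrictDerivAt hωd hω1 (inter_mem hN hreg)
      obtain ⟨y, hyV, hyA⟩ := mem_closure_iff.1 (frontier_subset_closure hzf) V hVo hzV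
      have hVreg : ∀ w ∈ V, w ∉ S ∧ (0 < jacobian f w ↔ ‖dilatation f w‖ < 1) ∧
          (jacobian f w < 0 ↔ 1 < ‖dilatation f w‖) := fun w hw => (hVN hw).2
      have hVone : ∀ w ∈ V, ‖dilatation f w‖ = 1 → w ∉ A := by
        intro w hw hw1 hwA
        refine hA.notMem_critSet hwA ⟨(hVreg w hw).1, ?_⟩
        refine le_antisymm ?_ ?_
        · exact not_lt.1 fun h => ((hVreg w hw).2.1.1 h).ne hw1
        · exact not_lt.1 fun h => ((hVreg w hw).2.2.1 h).ne' hw1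
      have hfr : ∀ w ∈ V, w ∈ closure A → w ∉ A → w ∈ frontier A := fun w _ h1 h2 => by
        rw [hAo.frontier_eq]; exact ⟨h1, h2⟩
      obtain ⟨p₀, hp₀V, hp₀⟩ := hln
      obtain ⟨q₀, hq₀V, hq₀⟩ := hgn
      rw [mem_ofPred_eq] at hp₀ hq₀
      have hj : ∀ p ∈ V, ∀ q ∈ V, ‖dilatation f p‖ < 1 → 1 < ‖dilatation f q‖ → F p - F q = 1 :=
        fun p hp q hq => hjump p (hVN hp).1 q (hVN hq).1
      have h00 := hj p₀ hp₀V q₀ hq₀V hp₀ hq₀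
      rcases hσ with ⟨rfl, hs⟩ | ⟨rfl, hs⟩
      · have hyl : ‖dilatation f y‖ < 1 :=
          (hVreg y hyV).2.1.1 (hA.jacobian_pos hf hs hyA (hVreg y hyV).1)
        have hlA : V ∩ {w | ‖dilatation f w‖ < 1} ⊆ A :=
          hA.subset_of_inter_nonempty hlc (fun w hw hwC => by
            have := (hVreg w hw.1).2.1.2 hw.2
            exact this.ne' hwC.2) ⟨y, hyA, hyV, hyl⟩
        have hgA : ∀ w ∈ V, 1 < ‖dilatation f w‖ → w ∉ A := by
          intro w hw hw1 hwA
          have h1 := hA.jacobian_pos hf hs hwA (hVreg w hw).1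
          have h2 := (hVreg w hw).2.2.2 hw1
          linarith
        -- The side |ω| < 1 lies in A and the side |ω| > 1 outside it. The jump against the fixed
        -- points p₀ and q₀ determines F on both sides; points with |ω| = 1 lie on ∂A and are not
        -- tested. For σ = -1 the sides exchange roles.
        refine ⟨F q₀, ?_⟩
        filter_upwards [hVo.mem_nhds hzV] with w hw hwf
        rcases lt_trichotomy ‖dilatation f w‖ 1 with h | h | h
        · rw [indicator_of_mem (hlA ⟨hw, h⟩)]
          linarith [hj w hw q₀ hq₀V h hq₀]
        · exact absurd (hfr w hw (closure_mono hlA (hlcl w hw h)) (hVone w hw h)) hwf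
        · rw [indicator_of_notMem (hgA w hw h)]
          linarith [hj p₀ hp₀V w hw hp₀ h]
      · have hyl : 1 < ‖dilatation f y‖ :=
          (hVreg y hyV).2.2.1 (hA.jacobian_neg hf hs hyA (hVreg y hyV).1)
        have hgA : V ∩ {w | 1 < ‖dilatation f w‖} ⊆ A :=
          hA.subset_of_inter_nonempty hgc (fun w hw hwC => by
            have := (hVreg w hw.1).2.2.2 hw.2
            exact this.ne hwC.2) ⟨y, hyA, hyV, hyl⟩
        have hlA : ∀ w ∈ V, ‖dilatation f w‖ < 1 → w ∉ A := by
          intro w hw hw1 hwA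
          have h1 := hA.jacobian_neg hf hs hwA (hVreg w hw).1
          have h2 := (hVreg w hw).2.1.2 hw1
          linarith
        refine ⟨F p₀, ?_⟩
        filter_upwards [hVo.mem_nhds hzV] with w hw hwf
        rcases lt_trichotomy ‖dilatation f w‖ 1 with h | h | h
        · rw [indicator_of_notMem (hlA w hw h)]
          linarith [hj w hw q₀ hq₀V h hq₀]
        · exact absurd (hfr w hw (closure_mono hgA (hgcl w hw h)) (hVone w hw h)) hwf
        · rw [indicator_of_mem (hgA ⟨hw, h⟩)]
          linarith [hj p₀ hp₀V w hw hp₀ h]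
    · have h1 := hγ.eventually_sum_windingNumber_eq (p := z) fun h => hzf h.1
      refine ⟨F z - A.indicator (fun _ => σ) z, ?_⟩
      have h2 : ∀ᶠ w in 𝓝 z, A.indicator (fun _ => σ) w = A.indicator (fun _ => σ) z := by
        by_cases hzA : z ∈ A
        · filter_upwards [hAo.mem_nhds hzA] with w hw
          rw [indicator_of_mem hw, indicator_of_mem hzA]
        · have hcl : z ∉ closure A := fun h => hzf (by rw [hAo.frontier_eq]; exact ⟨h, hzA⟩)
          filter_upwards [isClosed_closure.isOpen_compl.mem_nhds hcl] with w hw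
          rw [indicator_of_notMem (fun h => hw (subset_closure h)), indicator_of_notMem hzA]
      filter_upwards [h1, h2] with w hw1 hw2 _
      simp only [hF, hw1, hw2]
  obtain ⟨c, hc⟩ := exists_const_of_local_const hdense hE key inter_subset_right
  exact ⟨c, fun p hp => by linarith [hc p hp]⟩

end HarmonicCount

/-! ### Counting pre-images in a tile -/

namespace HarmonicCount

open Set Complex

variable {f : ℂ → ℂ} {S : Finset ℂ} {A : Set ℂ} {η : ℂ}

/-- `σ` is the sign of the Jacobian on `A`. -/
def IsSign (f : ℂ → ℂ) (A : Set ℂ) (σ : ℤ) : Prop :=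
  (σ = 1 ∧ ∀ z ∈ A, ∀ᶠ w in 𝓝[≠] z, 0 < jacobian f w) ∨
    (σ = -1 ∧ ∀ z ∈ A, ∀ᶠ w in 𝓝[≠] z, jacobian f w < 0)

theorem IsTile.exists_isSign (hf : NonDegenerate f S) (hA : IsTile f S A) : ∃ σ, IsSign f A σ := by
  rcases hA.exists_sign hf with h | h
  · exact ⟨1, Or.inl ⟨rfl, h⟩⟩
  · exact ⟨-1, Or.inr ⟨rfl, h⟩⟩

theorem IsSign.mul_self {σ : ℤ} (hσ : IsSign f A σ) : (σ : ℝ) * σ = 1 := by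
  rcases hσ with ⟨rfl, -⟩ | ⟨rfl, -⟩ <;> norm_num

theorem IsSign.hasIndexAt_preimage (hf : NonDegenerate f S) (hA : IsTile f S A) {σ : ℤ}
    (hσ : IsSign f A σ) {z : ℂ} (hz : z ∈ A) (hzS : z ∉ S) (hzη : f z = η) :
    HasIndexAt (fun w => f w - η) z σ := by
  have hd : DifferentiableAt ℝ (fun w => f w - η) z := (hf.differentiableAt hzS).sub_const η
  have hc : ∀ᶠ w in 𝓝 z, ContinuousAt (fun w => f w - η) w := by
    filter_upwards [(isOpen_notMem_finset S).mem_nhds hzS] with w hw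
      using (hf.continuousAt hw).sub continuousAt_const
  have hJ : jacobian (fun w => f w - η) z = jacobian f z := by
    simp only [jacobian, dz, dzbar, fderiv_sub_const]
  rcases hσ with ⟨rfl, hs⟩ | ⟨rfl, hs⟩
  · exact hasIndexAt_one_of_jacobian_pos (by simp [hzη]) hd hc
      (by rw [hJ]; exact hA.jacobian_pos hf hs hz hzS)
  · exact hasIndexAt_neg_one_of_jacobian_neg (by simp [hzη]) hd hc
      (by rw [hJ]; exact hA.jacobian_neg hf hs hz hzS)

/-- Around a pole, a positive Jacobian goes with index -n and a negative one with index n. Poles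
thus count with sign opposite to zeros, which is why |ind| enters the formula with a plus sign. -/
theorem IsSign.exists_index_pole (hf : NonDegenerate f S) {σ : ℤ} (hσ : IsSign f A σ) {z : ℂ}
    (hz : z ∈ A) (hzS : z ∈ S) :
    ∃ k : ℤ, HasIndexAt (fun w => f w - η) z k ∧ (k : ℝ) = -σ * |poincareIndex f z| := by
  have hcontra : ∀ {p : ℂ → Prop}, (∀ᶠ w in 𝓝[≠] z, p w) → (∀ᶠ w in 𝓝[≠] z, ¬ p w) → False :=
    fun h1 h2 => by
      obtain ⟨w, hw1, hw2⟩ := (h1.and h2).exists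
      exact hw2 hw1
  obtain ⟨m, ⟨hJ, hm⟩ | ⟨hJ, hm⟩⟩ := hf.exists_index_pole hzS <;>
    rcases hσ with ⟨rfl, hs⟩ | ⟨rfl, hs⟩
  · refine ⟨_, hf.hasIndexAt_sub_pole hzS hm η, ?_⟩
    rw [hm.poincareIndex_eq]
    simp
  · exact (hcontra hJ ((hs z hz).mono fun w hw => not_lt.2 hw.le)).elim
  · exact (hcontra hJ ((hs z hz).mono fun w hw => not_lt.2 hw.le)).elim
  · refine ⟨_, hf.hasIndexAt_sub_pole hzS hm η, ?_⟩
    rw [hm.poincareIndex_eq]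
    simp

/-- An accumulation point of pre-images cannot be a pole, where f tends to infinity. By continuity
it is a solution of f = η, hence not on ∂A, hence in A; but solutions in A have an index and are
isolated. -/
theorem IsTile.finite_preimages (hf : NonDegenerate f S) (hA : IsTile f S A)
    (hη : ∀ z ∈ frontier A, f z ≠ η) {R : ℝ} (hR : ∀ z ∈ A, f z = η → ‖z‖ ≤ R) :
    (preimages f S A η).Finite := by
  obtain ⟨σ, hσ⟩ := hA.exists_isSign hf
  by_contra hinf
  have hsub : preimages f S A η ⊆ closure A ∩ Metric.closedBall 0 R := fun z hz =>
    ⟨subset_closure hz.1, mem_closedBall_zero_iff.2 (hR z hz.1 hz.2.2)⟩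
  obtain ⟨x, hx, hacc⟩ := Set.Infinite.exists_accPt_of_subset_isCompact hinf
    ((isCompact_closedBall (0 : ℂ) R).inter_left isClosed_closure) hsub
  rw [accPt_iff_frequently_nhdsNE] at hacc
  by_cases hxS : x ∈ S
  · have h1 := (tendsto_norm_cobounded_atTop.comp (hf.pole x hxS)).eventually_gt_atTop ‖η‖
    refine hacc ?_
    filter_upwards [h1] with w hw hwp
    rw [Function.comp_apply, hwp.2.2] at hw
    exact lt_irrefl _ hw
  · have hxη : f x = η := by
      by_contra hne
      refine hacc ?_
      filter_upwards [nhdsWithin_le_nhds ((hf.continuousAt hxS).eventually_ne hne)] with w hw hwp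
      exact hw hwp.2.2
    have hxA : x ∈ A := by
      by_contra h
      exact hη x (by rw [(hA.isOpen hf).frontier_eq]; exact ⟨hx.1, h⟩) hxη
    refine hacc ?_
    filter_upwards [(hσ.hasIndexAt_preimage hf hA hxA hxS hxη).eventually_ne_zero] with w hw hwp
    exact hw (sub_eq_zero.2 hwp.2.2)

open Classical in
/-- The exceptional points of `f - η` in `A`. -/
noncomputable def exceptionalPoints (f : ℂ → ℂ) (S : Finset ℂ) (A : Set ℂ) (η : ℂ)
    (hfin : (preimages f S A η).Finite) : Finset ℂ :=
  hfin.toFinset ∪ {z ∈ S | z ∈ A}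

theorem mem_exceptionalPoints {hfin : (preimages f S A η).Finite} {z : ℂ} :
    z ∈ exceptionalPoints f S A η hfin ↔ z ∈ A ∧ (z ∈ S ∨ f z = η) := by
  simp only [exceptionalPoints, Finset.mem_union, Set.Finite.mem_toFinset, Finset.mem_filter,
    preimages, mem_ofPred_eq]
  tauto

theorem exists_index_exceptionalPoints (hf : NonDegenerate f S) (hA : IsTile f S A) {σ : ℤ}
    (hσ : IsSign f A σ) (hfin : (preimages f S A η).Finite) :
    ∃ k : ℂ → ℤ, (∀ z ∈ exceptionalPoints f S A η hfin, HasIndexAt (fun w => f w - η) z (k z)) ∧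
      ∑ z ∈ exceptionalPoints f S A η hfin, (k z : ℝ) =
        σ * ((preimages f S A η).ncard - poleCount f S A) := by
  classical
  have h1 : ∀ z, ∃ k : ℤ, z ∈ exceptionalPoints f S A η hfin →
      HasIndexAt (fun w => f w - η) z k ∧ (z ∉ S → k = σ) ∧
        (z ∈ S → (k : ℝ) = -σ * |poincareIndex f z|) := by
    intro z
    by_cases hz : z ∈ exceptionalPoints f S A η hfin
    · obtain ⟨hzA, hz'⟩ := mem_exceptionalPoints.1 hz
      by_cases hzS : z ∈ S
      · obtain ⟨k, hk, hk'⟩ := hσ.exists_index_pole (η := η) hf hzA hzS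
        exact ⟨k, fun _ => ⟨hk, fun h => absurd hzS h, fun _ => hk'⟩⟩
      · exact ⟨σ, fun _ => ⟨hσ.hasIndexAt_preimage hf hA hzA hzS (hz'.resolve_left hzS),
          fun _ => rfl, fun h => absurd h hzS⟩⟩
    · exact ⟨0, fun h => absurd h hz⟩
  choose k hk using h1
  refine ⟨k, fun z hz => (hk z hz).1, ?_⟩
  have hdisj : Disjoint hfin.toFinset {z ∈ S | z ∈ A} := by
    rw [Finset.disjoint_left]
    intro z hz hz'
    exact (hfin.mem_toFinset.1 hz).2.1 (Finset.mem_filter.1 hz').1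
  have hs1 : ∑ z ∈ hfin.toFinset, (k z : ℝ) = (preimages f S A η).ncard * σ := by
    rw [Finset.sum_congr rfl (g := fun _ => (σ : ℝ)), Finset.sum_const, nsmul_eq_mul,
      ncard_eq_toFinset_card _ hfin]
    intro z hz
    have hzp := hfin.mem_toFinset.1 hz
    rw [(hk z (mem_exceptionalPoints.2 ⟨hzp.1, Or.inr hzp.2.2⟩)).2.1 hzp.2.1]
  have hs2 : ∑ z ∈ S with z ∈ A, (k z : ℝ) = -σ * poleCount f S A := by
    rw [poleCount, Finset.mul_sum]
    refine Finset.sum_congr rfl fun z hz => ?_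
    obtain ⟨hzS, hzA⟩ := Finset.mem_filter.1 hz
    exact (hk z (mem_exceptionalPoints.2 ⟨hzA, Or.inl hzS⟩)).2.2 hzS
  rw [exceptionalPoints, Finset.sum_union hdisj, hs1, hs2]
  ring

/-- The argument principle for `f - η` and closed curves in the closure of a tile. -/
theorem exists_windingNumber_eq_sum (hf : NonDegenerate f S) (hA : IsTile f S A)
    (hη : ∀ z ∈ frontier A, f z ≠ η) (hfin : (preimages f S A η).Finite) {R : ℝ}
    (hQR : ∀ z ∈ exceptionalPoints f S A η hfin, ‖z‖ < R) {k : ℂ → ℤ}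
    (hk : ∀ z ∈ exceptionalPoints f S A η hfin, HasIndexAt (fun w => f w - η) z (k z)) :
    ∃ (Z : Finset ℂ) (l : ℂ → ℤ), (∀ z ∈ Z, z ∉ closure A ∨ R < ‖z‖) ∧
      ∀ (c : ℝ → ℂ) (a b : ℝ), a ≤ b → ContinuousOn c (Icc a b) → c a = c b →
        (∀ t ∈ Icc a b, c t ∈ closure A ∧ ‖c t‖ ≤ R ∧ c t ∉ exceptionalPoints f S A η hfin) →
        windingNumber (fun t => f (c t)) a b η =
          ∑ z ∈ exceptionalPoints f S A η hfin, k z * windingNumber c a b z +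
            ∑ z ∈ Z, l z * windingNumber c a b z := by
  classical
  set Q := exceptionalPoints f S A η hfin with hQ
  have hAo := hA.isOpen hf
  -- Truncation by a ball makes the region compact also for unbounded A. The new exceptional points
  -- lie off K, so each is outside closure A or beyond radius R.
  set K : Set ℂ := closure A ∩ Metric.closedBall 0 R with hKdef
  have hK : IsCompact K := (isCompact_closedBall (0 : ℂ) R).inter_left isClosed_closure
  let U : Set ℂ := {z | z ∉ S ∧ f z ≠ η}
  have hU : IsOpen U := by
    rw [isOpen_iff_eventually]
    intro z hz
    filter_upwards [(isOpen_notMem_finset S).mem_nhds hz.1,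
      (hf.continuousAt hz.1).eventually_ne hz.2] with w hw1 hw2 using ⟨hw1, hw2⟩
  have hQK : ↑Q ⊆ interior K := by
    have h1 : A ∩ Metric.ball 0 R ⊆ interior K :=
      interior_maximal (inter_subset_inter subset_closure Metric.ball_subset_closedBall)
        (hAo.inter Metric.isOpen_ball)
    intro z hz
    exact h1 ⟨(mem_exceptionalPoints.1 hz).1, mem_ball_zero_iff.2 (hQR z hz)⟩
  have hKU : K \ Q ⊆ U := by
    rintro z ⟨hzK, hzQ⟩
    by_cases hzA : z ∈ A
    · have h1 : ¬ (z ∈ A ∧ (z ∈ S ∨ f z = η)) := fun h => hzQ (mem_exceptionalPoints.2 h)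
      exact ⟨fun h => h1 ⟨hzA, Or.inl h⟩, fun h => h1 ⟨hzA, Or.inr h⟩⟩
    · have hfr : z ∈ frontier A := by rw [hAo.frontier_eq]; exact ⟨hzK.1, hzA⟩
      exact ⟨(hA.frontier_subset hf hfr).1, hη z hfr⟩
  obtain ⟨G, Z, l, hGf, hZK, hG, hl⟩ := exists_extension (g := fun z => f z - η) hK hU hQK hKU
    (fun z hz => ((hf.differentiableAt hz.1).sub_const η).differentiableWithinAt)
    (fun z hz => sub_ne_zero.2 hz.2)
  refine ⟨Z, l, fun z hz => ?_, fun c a b hab hc hcl hcK => ?_⟩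
  · by_contra! h
    exact hZK z hz ⟨h.1, mem_closedBall_zero_iff.2 h.2⟩
  have hQZ : Disjoint Q Z := Finset.disjoint_left.2 fun z hzQ hzZ =>
    hZK z hzZ (interior_subset (hQK hzQ))
  have hcK' : ∀ t ∈ Icc a b, c t ∈ K := fun t ht =>
    ⟨(hcK t ht).1, mem_closedBall_zero_iff.2 (hcK t ht).2.1⟩
  have h1 := winding_comp_eq_sum (fun z => if z ∈ Q then k z else l z) (Q ∪ Z) G
    (fun z hz => (hG z (fun h => hz (Finset.mem_union_right _ h))
      (fun h => hz (Finset.mem_union_left _ h))).1)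
    (fun z hz => (hG z (fun h => hz (Finset.mem_union_right _ h))
      (fun h => hz (Finset.mem_union_left _ h))).2)
    (fun z hz => by
      by_cases hzQ : z ∈ Q
      · rw [if_pos hzQ]
        refine (hk z hzQ).congr ?_
        filter_upwards [nhdsWithin_le_nhds (isOpen_interior.mem_nhds (hQK hzQ))] with w hw
        exact (hGf (interior_subset hw)).symm
      · rw [if_neg hzQ]
        exact hl z ((Finset.mem_union.1 hz).resolve_left hzQ))
    hab hc hcl (fun t ht h => by
      rcases Finset.mem_union.1 h with h | h
      · exact (hcK t ht).2.2 h
      · exact hZK _ h (hcK' t ht))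
  have h2 : windingNumber (fun t => f (c t)) a b η = winding (fun t => G (c t)) a b :=
    winding_congr fun t ht => (hGf (hcK' t ht)).symm
  rw [h2, h1, Finset.sum_union hQZ]
  congr 1
  · exact Finset.sum_congr rfl fun z hz => by rw [if_pos hz]
  · exact Finset.sum_congr rfl fun z hz => by rw [if_neg (Finset.disjoint_right.1 hQZ hz)]

theorem sum_windingNumber_curves {n : ℕ} {a b : Fin n → ℝ} {γ : Fin n → ℝ → ℂ} {Q Z : Finset ℂ}
    {k l : ℂ → ℤ}
    (h : ∀ j, windingNumber (fun t => f (γ j t)) (a j) (b j) η =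
      ∑ z ∈ Q, k z * windingNumber (γ j) (a j) (b j) z +
        ∑ z ∈ Z, l z * windingNumber (γ j) (a j) (b j) z) :
    ∑ j, windingNumber (fun t => f (γ j t)) (a j) (b j) η =
      ∑ z ∈ Q, k z * ∑ j, windingNumber (γ j) (a j) (b j) z +
        ∑ z ∈ Z, l z * ∑ j, windingNumber (γ j) (a j) (b j) z := by
  simp only [h, Finset.sum_add_distrib, Finset.mul_sum]
  rw [Finset.sum_comm, Finset.sum_comm (s := Finset.univ) (t := Z)]

theorem isPreconnected_norm_gt {R : ℝ} (hR : 0 < R) : IsPreconnected {z : ℂ | R < ‖z‖} := by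
  have h1 : {z : ℂ | R < ‖z‖} = exp '' {w | Real.log R < w.re} := by
    ext z
    constructor
    · intro hz
      have hz' : R < ‖z‖ := hz
      have hz0 : z ≠ 0 := norm_pos_iff.1 (hR.trans hz')
      refine ⟨log z, ?_, exp_log hz0⟩
      rw [mem_ofPred_eq, log_re]
      exact Real.log_lt_log hR hz'
    · rintro ⟨w, hw, rfl⟩
      have hw' : Real.log R < w.re := hw
      rw [mem_ofPred_eq, norm_exp]
      exact (Real.log_lt_iff_lt_exp hR).1 hw'
  rw [h1]
  exact (convex_halfSpace_re_gt _).isPreconnected.image _ continuous_exp.continuousOn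

theorem count_of_bounded (hf : NonDegenerate f S) (hA : IsTile f S A)
    (hη : ∀ z ∈ frontier A, f z ≠ η) {n : ℕ} {a b : Fin n → ℝ} {γ : Fin n → ℝ → ℂ}
    (hγ : IsCritParam f (frontier A \ exceptSet f S) a b γ) (hb : Bornology.IsBounded A) :
    (preimages f S A η).Finite ∧
      ((preimages f S A η).ncard : ℝ) =
        (∑ j, windingNumber (fun t => f (γ j t)) (a j) (b j) η) + poleCount f S A := by
  obtain ⟨σ, hσ⟩ := hA.exists_isSign hf
  obtain ⟨R, hR⟩ := hb.closure.exists_norm_le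
  have hfin := hA.finite_preimages hf hη (R := R) fun z hz _ => hR z (subset_closure hz)
  refine ⟨hfin, ?_⟩
  obtain ⟨k, hk, hksum⟩ := exists_index_exceptionalPoints hf hA hσ hfin
  obtain ⟨Z, l, hZ, hsum⟩ := exists_windingNumber_eq_sum hf hA hη hfin (R := R + 1)
    (fun z hz => by
      have := hR z (subset_closure (mem_exceptionalPoints.1 hz).1)
      linarith) hk
  obtain ⟨c, hc⟩ := hγ.exists_sum_windingNumber_eq hf hA (σ := σ)
    (hσ.imp (fun h => ⟨by simp [h.1], h.2⟩) (fun h => ⟨by simp [h.1], h.2⟩))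
  -- Evaluation far away: such points lie outside A and no curve winds about them.
  have hc0 : c = 0 := by
    have h1 : ∀ᶠ p in Bornology.cobounded ℂ, p ∉ closure A :=
      Bornology.isBounded_def.1 hb.closure
    obtain ⟨p, hp1, hp2⟩ := (h1.and hγ.eventually_sum_windingNumber_eq_zero).exists
    have h2 := hc p fun h => hp1 (frontier_subset_closure h)
    rw [hp2, indicator_of_notMem fun h => hp1 (subset_closure h)] at h2
    linarith
  have hAo := hA.isOpen hf
  have hgam := sum_windingNumber_curves (f := f) (η := η) fun j =>
    hsum (γ j) (a j) (b j) (hγ.lt j).le (hγ.continuousOn j) (hγ.closed j) fun t ht => by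
      have h1 : γ j t ∈ frontier A := (hγ.mem ht).1
      refine ⟨frontier_subset_closure h1, ?_, fun h2 => ?_⟩
      · have := hR _ (frontier_subset_closure h1)
        linarith
      · rw [hAo.frontier_eq] at h1
        exact h1.2 (mem_exceptionalPoints.1 h2).1
  have hQs : ∑ z ∈ exceptionalPoints f S A η hfin,
      k z * ∑ j, windingNumber (γ j) (a j) (b j) z =
      (∑ z ∈ exceptionalPoints f S A η hfin, (k z : ℝ)) * σ := by
    rw [Finset.sum_mul]
    refine Finset.sum_congr rfl fun z hz => ?_
    have hzA := (mem_exceptionalPoints.1 hz).1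
    rw [hc z (fun h => by rw [hAo.frontier_eq] at h; exact h.2 hzA), indicator_of_mem hzA, hc0,
      add_zero]
  have hZs : ∑ z ∈ Z, l z * ∑ j, windingNumber (γ j) (a j) (b j) z = 0 := by
    refine Finset.sum_eq_zero fun z hz => ?_
    have hzA : z ∉ closure A := by
      rcases hZ z hz with h | h
      · exact h
      · intro h'
        have := hR z h'
        linarith
    rw [hc z (fun h => hzA (frontier_subset_closure h)),
      indicator_of_notMem fun h => hzA (subset_closure h), hc0, add_zero, mul_zero]
  rw [hgam, hQs, hZs, hksum]
  linear_combination (poleCount f S A - ((preimages f S A η).ncard : ℝ)) * hσ.mul_self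

theorem count_of_unbounded (hf : NonDegenerate f S) (hA : IsTile f S A)
    (hη : ∀ z ∈ frontier A, f z ≠ η) {n : ℕ} {a b : Fin n → ℝ} {γ : Fin n → ℝ → ℂ}
    (hγ : IsCritParam f (frontier A \ exceptSet f S) a b γ) (hb : ¬ Bornology.IsBounded A)
    (hinf : ∀ᶠ z in Bornology.cobounded ℂ, f z ≠ η) :
    (preimages f S A η).Finite ∧
      ((preimages f S A η).ncard : ℝ) =
        (∑ j, windingNumber (fun t => f (γ j t)) (a j) (b j) η) + poleCount f S A
          - poincareIndexInfty (fun z => f z - η) := by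
  have hpi := Real.pi_pos
  have hAo := hA.isOpen hf
  have hS : ∀ᶠ z in Bornology.cobounded ℂ, z ∉ S :=
    Bornology.isBounded_def.1 S.finite_toSet.isBounded
  -- Beyond R₀ there are no poles, no pre-images and no critical points. This connected exterior
  -- region therefore lies in A and fixes the sign +1 there.
  obtain ⟨R₀, hR₀, hfar⟩ : ∃ R₀ > 0, ∀ z : ℂ, R₀ < ‖z‖ →
      z ∉ S ∧ f z ≠ η ∧ 0 < jacobian f z := by
    have h1 := hS.and (hinf.and hf.sense_preserving_infty)
    rw [← comap_norm_atTop, eventually_comap] at h1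
    obtain ⟨R₁, hR₁⟩ := eventually_atTop.1 h1
    exact ⟨max R₁ 1, by positivity, fun z hz =>
      hR₁ ‖z‖ ((le_max_left _ _).trans hz.le) z rfl⟩
  have hext : {z : ℂ | R₀ < ‖z‖} ⊆ A := by
    refine hA.subset_of_inter_nonempty (isPreconnected_norm_gt hR₀)
      (fun z hz hzC => (hfar z hz).2.2.ne' hzC.2) ?_
    by_contra h
    refine hb (Metric.isBounded_closedBall (x := (0 : ℂ)) (r := R₀) |>.subset fun z hz => ?_)
    rw [mem_closedBall_zero_iff]
    by_contra! hz'
    exact h ⟨z, hz, hz'⟩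
  have hfr : ∀ z ∈ frontier A, ‖z‖ ≤ R₀ := by
    intro z hz
    by_contra! h
    rw [hAo.frontier_eq] at hz
    exact hz.2 (hext h)
  have hpos : ∀ z ∈ A, ∀ᶠ w in 𝓝[≠] z, 0 < jacobian f w := by
    rcases hA.exists_sign hf with h | h
    · exact h
    · have hz : R₀ < ‖((R₀ + 1 : ℝ) : ℂ)‖ := by
        rw [norm_real, Real.norm_eq_abs, abs_of_pos (by linarith)]
        linarith
      have h1 := hfar _ hz
      have h2 := hA.jacobian_neg hf h (hext hz) h1.1
      linarith [h1.2.2]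
  have hσ : IsSign f A 1 := Or.inl ⟨rfl, hpos⟩
  have hfin := hA.finite_preimages hf hη (R := R₀) fun z _ hzη => by
    by_contra! h
    exact (hfar z h).2.1 hzη
  refine ⟨hfin, ?_⟩
  obtain ⟨k, hk, hksum⟩ := exists_index_exceptionalPoints hf hA hσ hfin
  rw [Int.cast_one, one_mul] at hksum
  have hQ : ∀ z ∈ exceptionalPoints f S A η hfin, ‖z‖ ≤ R₀ := by
    intro z hz
    by_contra! h
    rcases (mem_exceptionalPoints.1 hz).2 with h' | h'
    · exact (hfar z h).1 h'
    · exact (hfar z h).2.1 h'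
  obtain ⟨c, hc⟩ := hγ.exists_sum_windingNumber_eq hf hA (σ := 1) (Or.inl ⟨rfl, hpos⟩)
  -- Far points now belong to A, so 0 = 1 + c: the curves wind 0 times about points of A and -1
  -- times about points outside closure A.
  have hc0 : c = -1 := by
    have h1 : ∀ᶠ p : ℂ in Bornology.cobounded ℂ, R₀ < ‖p‖ :=
      tendsto_norm_cobounded_atTop.eventually_gt_atTop R₀
    obtain ⟨p, hp1, hp2⟩ := (h1.and hγ.eventually_sum_windingNumber_eq_zero).exists
    have h2 := hc p fun h => not_lt.2 (hfr p h) hp1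
    rw [hp2, indicator_of_mem (hext hp1)] at h2
    linarith
  -- Adding the circle of radius R to the curves gives a cycle with winding number 1 about every
  -- exceptional point in A, so the combined winding of f - η is the index sum N - P.
  have hcirc : ∀ R > R₀, winding (fun t => f (circleMap 0 R t) - η) 0 (2 * Real.pi) =
      (preimages f S A η).ncard - poleCount f S A -
        ∑ j, windingNumber (fun t => f (γ j t)) (a j) (b j) η := by
    intro R hR
    have hR0 : 0 < R := hR₀.trans hR
    have hnorm : ∀ t, ‖circleMap 0 R t‖ = R := fun t => by
      rw [norm_circleMap_zero, abs_of_pos hR0]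
    obtain ⟨Z, l, hZ, hsum⟩ := exists_windingNumber_eq_sum hf hA hη hfin (R := R)
      (fun z hz => (hQ z hz).trans_lt hR) hk
    have hgam := sum_windingNumber_curves (f := f) (η := η) fun j =>
      hsum (γ j) (a j) (b j) (hγ.lt j).le (hγ.continuousOn j) (hγ.closed j) fun t ht => by
        have h1 : γ j t ∈ frontier A := (hγ.mem ht).1
        refine ⟨frontier_subset_closure h1, (hfr _ h1).trans hR.le, fun h2 => ?_⟩
        rw [hAo.frontier_eq] at h1
        exact h1.2 (mem_exceptionalPoints.1 h2).1
    have hC := hsum (circleMap 0 R) 0 (2 * Real.pi) (by positivity)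
      (continuous_circleMap 0 R).continuousOn (by
        have := circleMap_add_two_pi 0 R 0
        rw [zero_add] at this
        exact this.symm) fun t _ => by
        refine ⟨subset_closure (hext (by rw [mem_ofPred_eq, hnorm]; exact hR)), (hnorm t).le,
          fun h => ?_⟩
        have := hQ _ h
        rw [hnorm] at this
        linarith
    have hwlt : ∀ z : ℂ, ‖z‖ < R → windingNumber (circleMap 0 R) 0 (2 * Real.pi) z = 1 :=
      fun z hz => by
        have := windingNumber_circleMap_of_lt (c := 0) (p := z) (R := R) (by simpa using hz) 0
        rwa [zero_add] at this
    have hwgt : ∀ z : ℂ, R < ‖z‖ → windingNumber (circleMap 0 R) 0 (2 * Real.pi) z = 0 :=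
      fun z hz => by
        have := windingNumber_circleMap_of_gt (c := 0) (p := z) (R := R) hR0.le
          (by simpa using hz) 0
        rwa [zero_add] at this
    have hQs : ∑ z ∈ exceptionalPoints f S A η hfin,
        k z * ∑ j, windingNumber (γ j) (a j) (b j) z = 0 := by
      refine Finset.sum_eq_zero fun z hz => ?_
      have hzA := (mem_exceptionalPoints.1 hz).1
      rw [hc z (fun h => by rw [hAo.frontier_eq] at h; exact h.2 hzA), indicator_of_mem hzA, hc0]
      ring
    have hQc : ∑ z ∈ exceptionalPoints f S A η hfin,
        k z * windingNumber (circleMap 0 R) 0 (2 * Real.pi) z =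
        ∑ z ∈ exceptionalPoints f S A η hfin, (k z : ℝ) :=
      Finset.sum_congr rfl fun z hz => by
        rw [hwlt z ((hQ z hz).trans_lt hR), mul_one]
    -- The new exceptional points cancel: outside closure A the curves contribute -1 and the circle
    -- +1, while beyond radius R both contribute 0.
    have hZs : ∑ z ∈ Z, l z * ∑ j, windingNumber (γ j) (a j) (b j) z +
        ∑ z ∈ Z, l z * windingNumber (circleMap 0 R) 0 (2 * Real.pi) z = 0 := by
      rw [← Finset.sum_add_distrib]
      refine Finset.sum_eq_zero fun z hz => ?_
      rcases hZ z hz with h | h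
      · have hzR : ‖z‖ < R := by
          by_contra! h'
          exact h (subset_closure (hext (hR.trans_le h')))
        rw [hc z (fun h' => h (frontier_subset_closure h')),
          indicator_of_notMem fun h' => h (subset_closure h'), hc0, hwlt z hzR]
        ring
      · have hzA : z ∈ A := hext (hR.trans h)
        rw [hc z (fun h' => by rw [hAo.frontier_eq] at h'; exact h'.2 hzA),
          indicator_of_mem hzA, hc0, hwgt z h]
        ring
    have hC' : winding (fun t => f (circleMap 0 R t) - η) 0 (2 * Real.pi) = _ := hC
    rw [hC', hgam, hQs, hQc, hksum]
    linarith
  -- The index at infinity uses negatively oriented circles, hence the minus sign; the winding is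
  -- already constant for R > R₀.
  have hlim : poincareIndexInfty (fun z => f z - η) =
      -((preimages f S A η).ncard - poleCount f S A -
        ∑ j, windingNumber (fun t => f (γ j t)) (a j) (b j) η) := by
    apply Tendsto.limUnder_eq
    refine tendsto_const_nhds.congr' ?_
    filter_upwards [eventually_gt_atTop R₀] with R hR
    have hR0 : 0 < R := hR₀.trans hR
    have hfarc : ∀ t, R₀ < ‖circleMap 0 R t‖ := fun t => by
      rw [norm_circleMap_zero, abs_of_pos hR0]
      exact hR
    rw [winding_circleMap_neg (g := fun z => f z - η), hcirc R hR]
    · intro t _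
      exact (((hf.continuousAt (hfar _ (hfarc t)).1).comp
        (continuous_circleMap 0 R).continuousAt).sub continuousAt_const).continuousWithinAt
    · intro t _
      exact sub_ne_zero.2 (hfar _ (hfarc t)).2.1
  rw [hlim]
  ring

end HarmonicCount

open HarmonicCount in
theorem theorem3p2 (f : ℂ → ℂ) (S : Finset ℂ) (hf : NonDegenerate f S) (η : ℂ)
    (A : Set ℂ) (hA : IsTile f S A) (hη : ∀ z ∈ frontier A, f z ≠ η)
    (n : ℕ) (a b : Fin n → ℝ) (γ : Fin n → ℝ → ℂ)
    (hγ : IsCritParam f (frontier A \ exceptSet f S) a b γ) :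
    (Bornology.IsBounded A →
      (preimages f S A η).Finite ∧
      ((preimages f S A η).ncard : ℝ) =
        (∑ j, windingNumber (fun t => f (γ j t)) (a j) (b j) η) + poleCount f S A) ∧
    (¬ Bornology.IsBounded A → (∀ᶠ z in Bornology.cobounded ℂ, f z ≠ η) →
      (preimages f S A η).Finite ∧
      ((preimages f S A η).ncard : ℝ) =
        (∑ j, windingNumber (fun t => f (γ j t)) (a j) (b j) η) + poleCount f S A
          - poincareIndexInfty (fun z => f z - η)) := by
  exact ⟨count_of_bounded hf hA hη hγ, count_of_unbounded hf hA hη hγ⟩
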